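/- Let $X$ be a random vector in $\mathbb R^p$ with $E(X)=0$ and $\max_{1\le k\le p}E|X_k|^4<\infty$, let $Y$ be a real random variable with $EY^2<\infty$, and let $\varepsilon$ be a real random variable (the error) independent of $X$. Let $\Theta\subset\mathbb R^d$ be compact and convex, and let $g:\mathbb R^p\times\mathbb R^d\to\mathbb R$ be such that $g(\cdot,\theta)$ is Borel measurable for each $\theta$ and, for each $x$, $g(x,\cdot)$ is twice continuously differentiable in a neighbourhood of $\Theta$. Write $\dot g=\partial g/\partial\theta$ and $\ddot g=\partial^2g/\partial\theta\,\partial\theta^\top$, let $\|\cdot\|$ be the Euclidean (for matrices: Frobenius) norm, and assume that $$E\sup_{\theta\in\Theta}g^2(X,\theta),\quad E\sup_{\theta\in\Theta}\|\dot g\dot g^\top(X,\theta)\|,\quad E\sup_{\theta\in\Theta}\|[Y-g(X,\theta)]^2\dot g\dot g^\top(X,\theta)\|,\quad E\sup_{\theta\in\Theta}\|[Y-g(X,\theta)]^2\ddot g(X,\theta)\|$$ are finite. Assume that $R(\theta)=E\{Y-g(X,\theta)\}^2$ has a unique minimiser $\theta^*$ over $\Theta$ and that $E[\dot g(X,\theta^*)\dot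 g(X,\theta^*)^\top]$ is nonsingular. Put $\eta=Y-g(X,\theta^*)$, let $F_\eta$ be the law of $\eta$, let $m(t)=E[X\exp(it\eta)]$ and $$M=\int m(t)\,m(t)^H\,dF_\eta(t).$$ Let $(x_1,y_1),(x_2,y_2),\dots$ be i.i.d. copies of $(X,Y)$, let $\hat\theta_n$ be a (measurable) minimiser of $\sum_{j=1}^n[y_j-g(x_j,\theta)]^2$ over $\Theta$, and put $\hat\eta_j=y_j-g(x_j,\hat\theta_n)$, $$\hat m_n(t)=\frac1n\sum_{j=1}^n x_j\exp(it\hat\eta_j),\qquad \hat M_n=\frac1n\sum_{j=1}^n\hat m_n(\hat\eta_j)\,\hat m_n(\hat\eta_j)^H .$$ Then: 1. Under the null hypothesis, that is, if $Y=g(X,\theta_0)+\varepsilon$ almost surely for some $\theta_0\in\Theta$, where $E\varepsilon=0$, and if $\theta^*$ is an interior point of $\Theta$, one has $\|\hat M_n-M\|=O_p(n^{-1})$. 2. Under the alternative hypothesis, that is, if $Y=G(X,\varepsilon)$ almost surely for some measurable function $G$ and for no $\theta\in\Theta$ is $Y=g(X,\theta)+\varepsilon$ almost surely, and if the minimiser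 $\theta^*$ is nondegenerate in the sense that there are $c,r>0$ with $R(\theta)\ge R(\theta^*)+c\|\theta-\theta^*\|^2$ for all $\theta\in\Theta$ with $\|\theta-\theta^*\|<r$, one has $\|\hat M_n-M\|=O_p(n^{-1/2})$. -/

import Mathlib

open MeasureTheory ProbabilityTheory
open scoped Matrix.Norms.Frobenius ENNReal

noncomputable section

/-- `Z n = O_p(a n)`: the ratio `|Z n| / a n` is bounded in probability, that is, for every `δ > 0`
there are `C` and `N` with `P(|Z n| > C * a n) ≤ δ` for all `n ≥ N`. -/
def IsBigOInProbability {S : Type*} [MeasurableSpace S] (P : Measure S)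
    (Z : ℕ → S → ℝ) (a : ℕ → ℝ) : Prop :=
  ∀ δ : ℝ, 0 < δ → ∃ C : ℝ, 0 < C ∧ ∃ N : ℕ, ∀ n : ℕ, N ≤ n →
    P {s | C * a n < |Z n s|} ≤ ENNReal.ofReal δ

variable {Ω S : Type*} [MeasurableSpace Ω] [MeasurableSpace S] {p d : ℕ}

/-- The vector `∂g(x,θ)/∂θ` of first partial derivatives in the parameter. -/
def paramGrad (g : EuclideanSpace ℝ (Fin p) → EuclideanSpace ℝ (Fin d) → ℝ)
    (x : EuclideanSpace ℝ (Fin p)) (θ : EuclideanSpace ℝ (Fin d)) : Fin d → ℝ :=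
  fun i => fderiv ℝ (g x) θ (EuclideanSpace.single i 1)

/-- The matrix `∂²g(x,θ)/∂θ∂θᵀ` of second partial derivatives in the parameter. -/
def paramHess (g : EuclideanSpace ℝ (Fin p) → EuclideanSpace ℝ (Fin d) → ℝ)
    (x : EuclideanSpace ℝ (Fin p)) (θ : EuclideanSpace ℝ (Fin d)) : Matrix (Fin d) (Fin d) ℝ :=
  Matrix.of fun i j =>
    fderiv ℝ (fun θ' => fderiv ℝ (g x) θ' (EuclideanSpace.single j 1)) θ
      (EuclideanSpace.single i 1)

/-- The population least squares criterion `E{Y - g(X,θ)}²`. -/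
def risk (μ : Measure Ω) (X : Ω → EuclideanSpace ℝ (Fin p)) (Y : Ω → ℝ)
    (g : EuclideanSpace ℝ (Fin p) → EuclideanSpace ℝ (Fin d) → ℝ)
    (θ : EuclideanSpace ℝ (Fin d)) : ℝ :=
  ∫ ω, (Y ω - g (X ω) θ) ^ 2 ∂μ

/-- The population residual `η = Y - g(X,θ)` (used with `θ` the least squares parameter). -/
def popResidual (X : Ω → EuclideanSpace ℝ (Fin p)) (Y : Ω → ℝ)
    (g : EuclideanSpace ℝ (Fin p) → EuclideanSpace ℝ (Fin d) → ℝ)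
    (θ : EuclideanSpace ℝ (Fin d)) : Ω → ℝ :=
  fun ω => Y ω - g (X ω) θ

/-- The matrix `E[ġ(X,θ) ġ(X,θ)ᵀ]`. -/
def gradGram (μ : Measure Ω) (X : Ω → EuclideanSpace ℝ (Fin p))
    (g : EuclideanSpace ℝ (Fin p) → EuclideanSpace ℝ (Fin d) → ℝ)
    (θ : EuclideanSpace ℝ (Fin d)) : Matrix (Fin d) (Fin d) ℝ :=
  Matrix.of fun i j => ∫ ω, paramGrad g (X ω) θ i * paramGrad g (X ω) θ j ∂μ

/-- The regularity conditions on the population `(X, Y)`, the parametric family `g`, the parameter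
space `Θ` and the population least squares parameter `θs`. Matrix norms are Frobenius norms. -/
structure RegularityConditions (μ : Measure Ω) (X : Ω → EuclideanSpace ℝ (Fin p)) (Y : Ω → ℝ)
    (g : EuclideanSpace ℝ (Fin p) → EuclideanSpace ℝ (Fin d) → ℝ)
    (Θ : Set (EuclideanSpace ℝ (Fin d))) (θs : EuclideanSpace ℝ (Fin d)) : Prop where
  measurable_X : Measurable X
  measurable_Y : Measurable Y
  integrable_Y_sq : Integrable (fun ω => Y ω ^ 2) μ
  isCompact : IsCompact Θ
  convex : Convex ℝ Θ
  measurable_g : ∀ θ, Measurable fun x => g x θ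
  /-- For each `x`, `g x` is twice continuously differentiable in a neighbourhood of `Θ`. -/
  contDiff_g : ∀ x, ∀ θ ∈ Θ, ContDiffAt ℝ 2 (g x) θ
  sup_g : ∫⁻ ω, ⨆ θ ∈ Θ, ENNReal.ofReal (g (X ω) θ ^ 2) ∂μ < ∞
  sup_grad : ∫⁻ ω, ⨆ θ ∈ Θ, ENNReal.ofReal
    ‖Matrix.vecMulVec (paramGrad g (X ω) θ) (paramGrad g (X ω) θ)‖ ∂μ < ∞
  sup_res_grad : ∫⁻ ω, ⨆ θ ∈ Θ, ENNReal.ofReal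
    ‖(Y ω - g (X ω) θ) ^ 2 •
      Matrix.vecMulVec (paramGrad g (X ω) θ) (paramGrad g (X ω) θ)‖ ∂μ < ∞
  sup_res_hess : ∫⁻ ω, ⨆ θ ∈ Θ, ENNReal.ofReal
    ‖(Y ω - g (X ω) θ) ^ 2 • paramHess g (X ω) θ‖ ∂μ < ∞
  mem : θs ∈ Θ
  unique_min : ∀ θ ∈ Θ, θ ≠ θs → risk μ X Y g θs < risk μ X Y g θ
  nonsingular : (gradGram μ X g θs).det ≠ 0

/-- The null hypothesis: `Y = g(X,θ₀) + ε` almost surely for some `θ₀ ∈ Θ`, with centred error `ε`.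
(Independence of `X` and `ε` is required separately, since it belongs to both hypotheses.) -/
def NullHypothesis (μ : Measure Ω) (X : Ω → EuclideanSpace ℝ (Fin p)) (Y ε : Ω → ℝ)
    (g : EuclideanSpace ℝ (Fin p) → EuclideanSpace ℝ (Fin d) → ℝ)
    (Θ : Set (EuclideanSpace ℝ (Fin d))) : Prop :=
  ∫ ω, ε ω ∂μ = 0 ∧ ∃ θ₀ ∈ Θ, ∀ᵐ ω ∂μ, Y ω = g (X ω) θ₀ + ε ω

/-- The alternative hypothesis: `Y = G(X,ε)` for some function `G`, and for no `θ ∈ Θ` is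
`Y = g(X,θ) + ε` almost surely. -/
def AlternativeHypothesis (μ : Measure Ω) (X : Ω → EuclideanSpace ℝ (Fin p)) (Y ε : Ω → ℝ)
    (g : EuclideanSpace ℝ (Fin p) → EuclideanSpace ℝ (Fin d) → ℝ)
    (Θ : Set (EuclideanSpace ℝ (Fin d))) : Prop :=
  (∃ G : EuclideanSpace ℝ (Fin p) → ℝ → ℝ, Measurable (Function.uncurry G) ∧
    ∀ᵐ ω ∂μ, Y ω = G (X ω) (ε ω)) ∧
  ∀ θ ∈ Θ, ¬ ∀ᵐ ω ∂μ, Y ω = g (X ω) θ + ε ω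

/-- `m(t) = E[X exp(itη)]`. -/
def charMoment (μ : Measure Ω) (X : Ω → EuclideanSpace ℝ (Fin p)) (η : Ω → ℝ) (t : ℝ) :
    Fin p → ℂ :=
  fun k => ∫ ω, (X ω k : ℂ) * Complex.exp (Complex.I * (t : ℂ) * (η ω : ℂ)) ∂μ

/-- The target matrix `M = ∫ m(t) m(t)ᴴ dF_η(t)`, with `F_η` the law of `η`. -/
def targetMatrix (μ : Measure Ω) (X : Ω → EuclideanSpace ℝ (Fin p)) (η : Ω → ℝ) :
    Matrix (Fin p) (Fin p) ℂ :=
  Matrix.of fun k l =>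
    ∫ t, Matrix.vecMulVec (charMoment μ X η t) (star (charMoment μ X η t)) k l ∂(μ.map η)

/-- `θ` minimises `∑_{j<n} (y_j - g(x_j,θ))²` over `Θ`. -/
def IsLeastSquares (g : EuclideanSpace ℝ (Fin p) → EuclideanSpace ℝ (Fin d) → ℝ)
    (Θ : Set (EuclideanSpace ℝ (Fin d))) (n : ℕ) (x : ℕ → EuclideanSpace ℝ (Fin p)) (y : ℕ → ℝ)
    (θ : EuclideanSpace ℝ (Fin d)) : Prop :=
  θ ∈ Θ ∧ ∀ θ' ∈ Θ, ∑ j ∈ Finset.range n, (y j - g (x j) θ) ^ 2 ≤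
    ∑ j ∈ Finset.range n, (y j - g (x j) θ') ^ 2

/-- `m̂_n(t) = n⁻¹ ∑_{j<n} x_j exp(it e_j)`, for residuals `e_j`. -/
def charMomentEst (n : ℕ) (x : ℕ → EuclideanSpace ℝ (Fin p)) (e : ℕ → ℝ) (t : ℝ) : Fin p → ℂ :=
  fun k => (n : ℂ)⁻¹ * ∑ j ∈ Finset.range n,
    (x j k : ℂ) * Complex.exp (Complex.I * (t : ℂ) * (e j : ℂ))

/-- `M̂_n = n⁻¹ ∑_{j<n} m̂_n(η̂_j) m̂_n(η̂_j)ᴴ` with `η̂_j = y_j - g(x_j,θ)`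
(used with `θ` the least squares estimate). -/
def targetMatrixEst (g : EuclideanSpace ℝ (Fin p) → EuclideanSpace ℝ (Fin d) → ℝ)
    (n : ℕ) (x : ℕ → EuclideanSpace ℝ (Fin p)) (y : ℕ → ℝ) (θ : EuclideanSpace ℝ (Fin d)) :
    Matrix (Fin p) (Fin p) ℂ :=
  let e : ℕ → ℝ := fun j => y j - g (x j) θ
  (n : ℂ)⁻¹ • ∑ j ∈ Finset.range n,
    Matrix.vecMulVec (charMomentEst n x e (e j)) (star (charMomentEst n x e (e j)))

end

/-!
The proof splits into the rate of the least squares estimator `θ̂`, an expansion of `m̂_n`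
around the true residuals, and the passage from `m̂_n` to the matrices.

*Rate.* The criterion `ρ_θ = (y - g(x, θ))²` is Lipschitz in `θ` on the convex set `Θ`, and its
Lipschitz constant is square integrable by the moment condition on `(Y - g)² ġ ġᵀ`. If its mean
grows quadratically around `θ*`, then `‖θ̂ - θ*‖ = O_p(n ^ (-1/2))`
(`isBigOInProbability_minimizer`). Second derivatives of `g` are not controlled where the
residual is small, so this rests on empirical process theory instead of a Taylor expansion: the
maximal inequality `lintegral_iSup_empirical_le` is obtained by symmetrization from a chaining
bound for Rademacher sums (`sum_iSup_signedSum_le`), and is applied on dyadic shells around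
`θ*`. Quadratic growth is assumed under the alternative. Under the null hypothesis the criterion
is the error variance plus `E(g(X, θ) - g(X, θ*))²`, which grows quadratically because `E[ġ ġᵀ]`
is nonsingular; compactness extends the growth from a neighbourhood of `θ*` to `Θ`.

*Expansion.* Replacing the residuals `η̂_j` in `m̂_n(η̂_j)` by `η_j` costs `‖θ̂ - θ*‖` times
averages that are bounded in probability, because `exp` is Lipschitz on the imaginary axis. At
the true residuals, `m̂_n(η_j) - m(η_j)` is an average of variables that are centred and
orthogonal given `(x_j, y_j)`, apart from one negligible term, and so has mean square of order
`1 / n`. Hence the sample mean of `|m̂_n(η̂_j) - m(η_j)|²` is `O_p(1/n)` under either hypothesis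
(`isBigOInProbability_charMomentEst`).

*Matrices.* Under the null hypothesis `m = 0`, because `X` is centred and independent of `η`;
then `M = 0` and `M̂_n` is bounded by that sample mean, which gives the rate `1 / n`. In general
the Cauchy–Schwarz inequality gives the square root of this rate, which is also the rate of the
average of `m(η_j) m(η_j)ᴴ` around `M`.
-/

/-! ### Calculus of stochastic order -/

namespace IsBigOInProbability

variable {S : Type*} [MeasurableSpace S] {P : Measure S} {Z Z' : ℕ → S → ℝ} {a b : ℕ → ℝ}

theorem mono (h : IsBigOInProbability P Z a)
    (hle : ∀ n, 1 ≤ n → ∀ᵐ s ∂P, |Z' n s| ≤ |Z n s|) : IsBigOInProbability P Z' a := by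
  intro δ hδ
  obtain ⟨C, hC, N, hN⟩ := h δ hδ
  refine ⟨C, hC, max N 1, fun n hn => ?_⟩
  refine le_trans (measure_mono_ae ?_) (hN n (le_trans (le_max_left _ _) hn))
  filter_upwards [hle n (le_trans (le_max_right _ _) hn)] with s hs hlt
  exact lt_of_lt_of_le hlt hs

theorem add (hZ : IsBigOInProbability P Z a) (hZ' : IsBigOInProbability P Z' a) :
    IsBigOInProbability P (fun n s => Z n s + Z' n s) a := by
  intro δ hδ
  obtain ⟨C, hC, N, hN⟩ := hZ (δ / 2) (by positivity)
  obtain ⟨C', hC', N', hN'⟩ := hZ' (δ / 2) (by positivity)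
  refine ⟨C + C', by positivity, max N N', fun n hn => ?_⟩
  have h1 := hN n (le_trans (le_max_left _ _) hn)
  have h2 := hN' n (le_trans (le_max_right _ _) hn)
  calc P {s | (C + C') * a n < |Z n s + Z' n s|}
      ≤ P ({s | C * a n < |Z n s|} ∪ {s | C' * a n < |Z' n s|}) := by
        refine measure_mono fun s hs => ?_
        by_contra hcon
        simp only [Set.mem_union, Set.mem_ofPred_eq, not_or, not_lt] at hcon hs
        have := abs_add_le (Z n s) (Z' n s)
        linarith [hcon.1, hcon.2]
    _ ≤ _ := measure_union_le _ _
    _ ≤ ENNReal.ofReal (δ / 2) + ENNReal.ofReal (δ / 2) := add_le_add h1 h2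
    _ = ENNReal.ofReal δ := by
        rw [← ENNReal.ofReal_add (by positivity) (by positivity), add_halves]

theorem mul (hZ : IsBigOInProbability P Z a) (hZ' : IsBigOInProbability P Z' b)
    (ha : ∀ n, 0 ≤ a n) :
    IsBigOInProbability P (fun n s => Z n s * Z' n s) (fun n => a n * b n) := by
  intro δ hδ
  obtain ⟨C, hC, N, hN⟩ := hZ (δ / 2) (by positivity)
  obtain ⟨C', hC', N', hN'⟩ := hZ' (δ / 2) (by positivity)
  refine ⟨C * C', by positivity, max N N', fun n hn => ?_⟩
  have h1 := hN n (le_trans (le_max_left _ _) hn)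
  have h2 := hN' n (le_trans (le_max_right _ _) hn)
  calc P {s | C * C' * (a n * b n) < |Z n s * Z' n s|}
      ≤ P ({s | C * a n < |Z n s|} ∪ {s | C' * b n < |Z' n s|}) := by
        refine measure_mono fun s hs => ?_
        by_contra hcon
        simp only [Set.mem_union, Set.mem_ofPred_eq, not_or, not_lt] at hcon hs
        rw [abs_mul] at hs
        have := mul_le_mul hcon.1 hcon.2 (abs_nonneg _) (mul_nonneg hC.le (ha n))
        nlinarith
    _ ≤ _ := measure_union_le _ _
    _ ≤ ENNReal.ofReal (δ / 2) + ENNReal.ofReal (δ / 2) := add_le_add h1 h2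
    _ = ENNReal.ofReal δ := by
        rw [← ENNReal.ofReal_add (by positivity) (by positivity), add_halves]

theorem congr_rate (h : IsBigOInProbability P Z a) (hab : ∀ n, 1 ≤ n → a n = b n) :
    IsBigOInProbability P Z b := by
  intro δ hδ
  obtain ⟨C, hC, N, hN⟩ := h δ hδ
  refine ⟨C, hC, max N 1, fun n hn => ?_⟩
  rw [← hab n (le_trans (le_max_right _ _) hn)]
  exact hN n (le_trans (le_max_left _ _) hn)

theorem const_mul (h : IsBigOInProbability P Z a) (c : ℝ) :
    IsBigOInProbability P (fun n s => c * Z n s) a := by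
  have hc : IsBigOInProbability P (fun _ _ => c) (fun _ => 1) := by
    intro δ _
    refine ⟨|c| + 1, by positivity, 0, fun n _ => ?_⟩
    have : {s : S | (|c| + 1) * 1 < |c|} = ∅ := by
      ext s; simp only [Set.mem_ofPred_eq, Set.mem_empty_iff_false, iff_false, not_lt]; linarith
    rw [this]; simp
  exact (hc.mul h fun _ => zero_le_one).congr_rate fun n _ => by simp

theorem sqrt (h : IsBigOInProbability P Z a) :
    IsBigOInProbability P (fun n s => √(Z n s)) (fun n => √(a n)) := by
  intro δ hδ
  obtain ⟨C, hC, N, hN⟩ := h δ hδ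
  refine ⟨√C, by positivity, N, fun n hn => le_trans (measure_mono fun s hs => ?_) (hN n hn)⟩
  simp only [Set.mem_ofPred_eq] at hs ⊢
  rw [abs_of_nonneg (Real.sqrt_nonneg _), ← Real.sqrt_mul hC.le] at hs
  by_contra hcon
  exact absurd hs (not_lt.2 (Real.sqrt_le_sqrt ((le_abs_self _).trans (not_lt.1 hcon))))

theorem sum {ι : Type*} (J : Finset ι) {Z : ι → ℕ → S → ℝ}
    (h : ∀ k ∈ J, IsBigOInProbability P (Z k) a) (ha : ∀ n, 0 ≤ a n) :
    IsBigOInProbability P (fun n s => ∑ k ∈ J, Z k n s) a := by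
  classical
  induction J using Finset.induction_on with
  | empty =>
    intro δ _
    refine ⟨1, one_pos, 0, fun n _ => ?_⟩
    have : {s : S | 1 * a n < |∑ k ∈ (∅ : Finset ι), Z k n s|} = ∅ := by
      ext s; simpa using ha n
    rw [this]; simp
  | insert k J hk ih =>
    have := (h k (Finset.mem_insert_self _ _)).add
      (ih fun j hj => h j (Finset.mem_insert_of_mem hj))
    exact this.mono fun n _ => Filter.Eventually.of_forall fun s => by
      rw [Finset.sum_insert hk]

/-- Markov's inequality: a bound on first absolute moments is a bound in probability. -/
theorem of_lintegral_le {K : ℝ} (hmeas : ∀ n, AEMeasurable (Z n) P) (ha : ∀ n, 1 ≤ n → 0 < a n)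
    (h : ∀ n, 1 ≤ n → ∫⁻ s, ‖Z n s‖ₑ ∂P ≤ ENNReal.ofReal (K * a n)) :
    IsBigOInProbability P Z a := by
  intro δ hδ
  refine ⟨(|K| + 1) / δ, by positivity, 1, fun n hn => ?_⟩
  have han := ha n hn
  have hpos : 0 < (|K| + 1) / δ * a n := by positivity
  calc P {s | (|K| + 1) / δ * a n < |Z n s|}
      ≤ P {s | ENNReal.ofReal ((|K| + 1) / δ * a n) ≤ ‖Z n s‖ₑ} := by
        refine measure_mono fun s hs => ?_
        simp only [Set.mem_ofPred_eq] at hs ⊢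
        rw [Real.enorm_eq_ofReal_abs]
        exact ENNReal.ofReal_le_ofReal hs.le
    _ ≤ (∫⁻ s, ‖Z n s‖ₑ ∂P) / ENNReal.ofReal ((|K| + 1) / δ * a n) :=
        meas_ge_le_lintegral_div (hmeas n).enorm (by simpa using hpos) ENNReal.ofReal_ne_top
    _ ≤ ENNReal.ofReal (K * a n) / ENNReal.ofReal ((|K| + 1) / δ * a n) := by
        gcongr; exact h n hn
    _ = ENNReal.ofReal (K * a n / ((|K| + 1) / δ * a n)) :=
        (ENNReal.ofReal_div_of_pos hpos).symm
    _ ≤ ENNReal.ofReal δ := by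
        refine ENNReal.ofReal_le_ofReal ?_
        rw [div_le_iff₀ hpos]
        have : δ * ((|K| + 1) / δ * a n) = (|K| + 1) * a n := by field_simp
        rw [this]
        exact mul_le_mul_of_nonneg_right ((le_abs_self K).trans (by linarith)) han.le

end IsBigOInProbability

/-- Sample averages of an integrable function are bounded in probability. -/
theorem isBigOInProbability_average {S W : Type*} [MeasurableSpace S] [MeasurableSpace W]
    {P : Measure S} {ν : Measure W} {w : ℕ → S → W}
    (hw : ∀ j, Measurable (w j)) (hlaw : ∀ j, P.map (w j) = ν) {f : W → ℝ} (hf : Measurable f)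
    (hint : Integrable f ν) :
    IsBigOInProbability P (fun n s => (n : ℝ)⁻¹ * ∑ j ∈ Finset.range n, f (w j s))
      (fun _ => 1) := by
  refine IsBigOInProbability.of_lintegral_le (K := ∫ v, |f v| ∂ν)
    (fun n => Measurable.aemeasurable ?_) (fun _ _ => one_pos) fun n hn => ?_
  · exact (Finset.measurable_sum _ fun j _ => hf.comp (hw j)).const_mul _
  have hn' : (0 : ℝ) < n := by exact_mod_cast hn
  have h1 : ∀ j, ∫⁻ s, ‖f (w j s)‖ₑ ∂P = ENNReal.ofReal (∫ v, |f v| ∂ν) := by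
    intro j
    rw [← lintegral_map (f := fun v => ‖f v‖ₑ) hf.enorm (hw j), hlaw j]
    exact (ofReal_integral_norm_eq_lintegral_enorm hint).symm
  calc ∫⁻ s, ‖(n : ℝ)⁻¹ * ∑ j ∈ Finset.range n, f (w j s)‖ₑ ∂P
      ≤ ∫⁻ s, ‖(n : ℝ)⁻¹‖ₑ * ∑ j ∈ Finset.range n, ‖f (w j s)‖ₑ ∂P := by
        refine lintegral_mono fun s => ?_
        rw [enorm_mul]
        gcongr
        exact enorm_sum_le _ _
    _ = ENNReal.ofReal ((n : ℝ)⁻¹) * ∑ j ∈ Finset.range n, ENNReal.ofReal (∫ v, |f v| ∂ν) := by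
        rw [lintegral_const_mul' _ _ (by simp [enorm_ne_top]), lintegral_finsetSum (μ := P)
          (f := fun j s => ‖f (w j s)‖ₑ) _ fun j _ => (hf.comp (hw j)).enorm,
          Real.enorm_of_nonneg (by positivity)]
        simp_rw [h1]
    _ ≤ _ := by
        rw [Finset.sum_const, Finset.card_range, nsmul_eq_mul, ← ENNReal.ofReal_natCast,
          ← ENNReal.ofReal_mul (by positivity), ← ENNReal.ofReal_mul (by positivity)]
        refine ENNReal.ofReal_le_ofReal (le_of_eq ?_)
        field_simp

/-! ### Chaining for Rademacher sums -/

/-- The signed sum `∑ i, ±a i`, the sign being `+` exactly where `σ i` is `true`. -/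
def signedSum {n : ℕ} (σ : Fin n → Bool) (a : Fin n → ℝ) : ℝ :=
  ∑ i, (if σ i then 1 else -1) * a i

theorem signedSum_sub {n : ℕ} (σ : Fin n → Bool) (a b : Fin n → ℝ) :
    signedSum σ (a - b) = signedSum σ a - signedSum σ b := by
  simp [signedSum, mul_sub, Finset.sum_sub_distrib]

theorem signedSum_smul {n : ℕ} (σ : Fin n → Bool) (c : ℝ) (a : Fin n → ℝ) :
    signedSum σ (c • a) = c * signedSum σ a := by
  simp only [signedSum, Pi.smul_apply, smul_eq_mul, Finset.mul_sum]
  exact Finset.sum_congr rfl fun i _ => by ring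

theorem abs_signedSum_le {n : ℕ} (σ : Fin n → Bool) (a : Fin n → ℝ) :
    |signedSum σ a| ≤ ∑ i, |a i| := by
  refine (Finset.abs_sum_le_sum_abs _ _).trans (Finset.sum_le_sum fun i _ => ?_)
  rw [abs_mul]
  split_ifs <;> simp

theorem sum_exp_signedSum_le {n : ℕ} (a : Fin n → ℝ) :
    ∑ σ : Fin n → Bool, Real.exp (signedSum σ a) ≤ 2 ^ n * Real.exp ((∑ i, a i ^ 2) / 2) := by
  have h : ∑ σ : Fin n → Bool, Real.exp (signedSum σ a) = ∏ i, (2 * Real.cosh (a i)) := by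
    have := Finset.prod_univ_sum (fun _ : Fin n => (Finset.univ : Finset Bool))
      (fun i b => Real.exp ((if b then 1 else -1) * a i))
    rw [Fintype.piFinset_univ] at this
    simp only [signedSum, Real.exp_sum]
    rw [← this]
    refine Finset.prod_congr rfl fun i _ => ?_
    rw [Real.cosh_eq]
    simp
    ring
  rw [h, Finset.prod_mul_distrib, Finset.sum_div, Real.exp_sum]
  simp only [Finset.prod_const, Finset.card_univ, Fintype.card_fin]
  gcongr with i
  exact Real.cosh_le_exp_half_sq _

/-- A maximal inequality: among at most `exp m` signed sums of vectors of length at most `s`, the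
largest is `s * (m + 4)` on average over the signs. The inequality `u ≤ m + exp (u - m)` replaces
the maximum by a sum of exponentials. -/
theorem exists_signedSum_majorant {n : ℕ} {ι : Type*} (J : Finset ι) (v : ι → Fin n → ℝ)
    {s m : ℝ} (hs : 0 ≤ s) (hv : ∀ j ∈ J, ∑ i, v j i ^ 2 ≤ s ^ 2) (hm : 0 ≤ m)
    (hJ : (J.card : ℝ) ≤ Real.exp m) :
    ∃ B : (Fin n → Bool) → ℝ, (∀ σ, 0 ≤ B σ) ∧ (∀ σ, ∀ j ∈ J, |signedSum σ (v j)| ≤ B σ) ∧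
      ∑ σ, B σ ≤ 2 ^ n * (s * (m + 4)) := by
  rcases hs.eq_or_lt with rfl | hs
  · refine ⟨fun _ => 0, fun _ => le_rfl, fun σ j hj => ?_, by simp⟩
    have h0 : ∀ i, v j i = 0 := fun i => by
      have h1 : v j i ^ 2 ≤ ∑ i, v j i ^ 2 := Finset.single_le_sum
        (f := fun i => v j i ^ 2) (fun i _ => sq_nonneg _)
        (Finset.mem_univ i)
      have h2 := hv j hj
      have : v j i ^ 2 = 0 := le_antisymm (by linarith) (sq_nonneg _)
      simpa using this
    simp [signedSum, h0]
  have hexp : ∀ j ∈ J, ∀ c : ℝ, c ^ 2 = 1 →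
      ∑ σ, Real.exp (c / s * signedSum σ (v j)) ≤ 2 ^ n * 2 := by
    intro j hj c hc
    calc ∑ σ, Real.exp (c / s * signedSum σ (v j))
        = ∑ σ, Real.exp (signedSum σ ((c / s) • v j)) := by simp_rw [signedSum_smul]
      _ ≤ 2 ^ n * Real.exp ((∑ i, ((c / s) • v j) i ^ 2) / 2) := sum_exp_signedSum_le _
      _ ≤ 2 ^ n * 2 := by
          gcongr
          have h1 : ∑ i, ((c / s) • v j) i ^ 2 ≤ 1 := by
            simp only [Pi.smul_apply, smul_eq_mul, mul_pow, div_pow, hc]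
            rw [← Finset.mul_sum, one_div, inv_mul_le_iff₀ (by positivity)]
            simpa using hv j hj
          have h2 : Real.exp (1 / 2) ^ 2 ≤ 2 ^ 2 := by
            rw [← Real.exp_nat_mul]
            norm_num
            linarith [Real.exp_one_lt_d9]
          have h3 : Real.exp (1 / 2) ≤ 2 := by
            nlinarith [Real.exp_pos (1 / 2)]
          exact (Real.exp_le_exp.2 (by linarith)).trans h3
  refine ⟨fun σ => s * (m + Real.exp (-m) * ∑ j ∈ J, (Real.exp (1 / s * signedSum σ (v j)) +
    Real.exp (-1 / s * signedSum σ (v j)))), fun σ => by positivity, fun σ j hj => ?_, ?_⟩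
  · have h1 : Real.exp (|signedSum σ (v j)| / s) ≤ ∑ j ∈ J,
        (Real.exp (1 / s * signedSum σ (v j)) + Real.exp (-1 / s * signedSum σ (v j))) := by
      refine le_trans ?_ (Finset.single_le_sum (f := fun j =>
        Real.exp (1 / s * signedSum σ (v j)) + Real.exp (-1 / s * signedSum σ (v j)))
        (fun j _ => by positivity) hj)
      rcases abs_cases (signedSum σ (v j)) with ⟨h, _⟩ | ⟨h, _⟩ <;> rw [h]
      · rw [show signedSum σ (v j) / s = 1 / s * signedSum σ (v j) by ring]
        linarith [Real.exp_pos (-1 / s * signedSum σ (v j))]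
      · rw [show -signedSum σ (v j) / s = -1 / s * signedSum σ (v j) by ring]
        linarith [Real.exp_pos (1 / s * signedSum σ (v j))]
    have h2 : |signedSum σ (v j)| / s - m + 1 ≤
        Real.exp (-m) * Real.exp (|signedSum σ (v j)| / s) := by
      rw [← Real.exp_add, show -m + |signedSum σ (v j)| / s = |signedSum σ (v j)| / s - m by ring]
      exact Real.add_one_le_exp _
    have h3 := mul_le_mul_of_nonneg_left h1 (Real.exp_pos (-m)).le
    calc |signedSum σ (v j)| = s * (|signedSum σ (v j)| / s) := by field_simp
      _ ≤ _ := mul_le_mul_of_nonneg_left (by linarith) hs.le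
  · have hsum : ∑ σ : Fin n → Bool, ∑ j ∈ J, (Real.exp (1 / s * signedSum σ (v j)) +
        Real.exp (-1 / s * signedSum σ (v j))) ≤ Real.exp m * (2 ^ n * 4) := by
      rw [Finset.sum_comm]
      calc _ ≤ ∑ j ∈ J, ((2 : ℝ) ^ n * 4) := by
            refine Finset.sum_le_sum fun j hj => ?_
            rw [Finset.sum_add_distrib]
            linarith [hexp j hj 1 (by norm_num), hexp j hj (-1) (by norm_num)]
        _ = (J.card : ℝ) * (2 ^ n * 4) := by simp
        _ ≤ _ := by gcongr
    rw [← Finset.mul_sum, Finset.sum_add_distrib, ← Finset.mul_sum]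
    simp only [Finset.sum_const, Finset.card_univ, Fintype.card_pi, Fintype.card_bool,
      Finset.prod_const, Fintype.card_fin, nsmul_eq_mul]
    have := mul_le_mul_of_nonneg_left hsum (Real.exp_pos (-m)).le
    rw [← mul_assoc, ← Real.exp_add, neg_add_cancel, Real.exp_zero, one_mul] at this
    push_cast
    have := mul_le_mul_of_nonneg_left this hs.le
    linarith

/-- A subset of a ball of radius `δ` in `ℝᵈ` has internal nets of radius of order `δ / 2 ^ k` with
at most `exp (d * (k + 2))` points: one point for each cell that the subset meets of a cubic grid of
mesh `δ / 2 ^ k`. -/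
theorem exists_finset_net {d : ℕ} {T : Set (EuclideanSpace ℝ (Fin d))}
    {c : EuclideanSpace ℝ (Fin d)} {δ : ℝ} (hδ : 0 < δ) (hT : ∀ θ ∈ T, ‖θ - c‖ ≤ δ) (k : ℕ) :
    ∃ F : Finset (EuclideanSpace ℝ (Fin d)), (∀ θ ∈ F, θ ∈ T) ∧
      (F.card : ℝ) ≤ Real.exp (d * (k + 2)) ∧
      ∀ θ ∈ T, ∃ θ' ∈ F, ‖θ - θ'‖ ≤ √d * (δ / 2 ^ k) := by
  classical
  let q : EuclideanSpace ℝ (Fin d) → Fin d → ℤ := fun θ i => ⌊2 ^ k * ((θ i - c i) / δ)⌋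
  let J : Finset (Fin d → ℤ) := Fintype.piFinset fun _ => Finset.Icc (-2 ^ k) (2 ^ k)
  have hq : ∀ θ ∈ T, q θ ∈ J := by
    intro θ hθ
    rw [Fintype.mem_piFinset]
    intro i
    have h1 : |(θ i - c i) / δ| ≤ 1 := by
      rw [abs_div, abs_of_pos hδ, div_le_one hδ]
      have := PiLp.norm_apply_le (θ - c) i
      rw [PiLp.sub_apply, Real.norm_eq_abs] at this
      exact this.trans (hT θ hθ)
    rw [abs_le] at h1
    have h2 : (0 : ℝ) < 2 ^ k := by positivity
    rw [Finset.mem_Icc]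
    constructor
    · rw [Int.le_floor]; push_cast; nlinarith
    · have : (⌊2 ^ k * ((θ i - c i) / δ)⌋ : ℝ) ≤ 2 ^ k :=
        (Int.floor_le _).trans (by nlinarith)
      exact_mod_cast this
  choose! rep hrep using fun z : Fin d → ℤ => fun h : ∃ θ ∈ T, q θ = z => h
  refine ⟨(J.filter fun z => ∃ θ ∈ T, q θ = z).image rep, ?_, ?_, ?_⟩
  · intro θ hθ
    obtain ⟨z, hz, rfl⟩ := Finset.mem_image.1 hθ
    exact (hrep z (Finset.mem_filter.1 hz).2).1
  · have h1 : ((J.filter fun z => ∃ θ ∈ T, q θ = z).image rep).card ≤ J.card :=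
      Finset.card_image_le.trans (Finset.card_filter_le _ _)
    have h2 : (J.card : ℝ) ≤ Real.exp (k + 2) ^ d := by
      simp only [J, Fintype.card_piFinset, Int.card_Icc, Finset.prod_const, Finset.card_univ,
        Fintype.card_fin]
      push_cast
      gcongr
      have h3 : (((2 ^ k + 1 - -2 ^ k : ℤ).toNat : ℤ) : ℝ) = 2 ^ k + 1 + 2 ^ k := by
        rw [Int.toNat_of_nonneg (by linarith [pow_pos (two_pos : (0 : ℤ) < 2) k])]; push_cast; ring
      have h4 : (((2 ^ k + 1 - -2 ^ k : ℤ).toNat : ℝ)) = 2 ^ k + 1 + 2 ^ k := by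
        exact_mod_cast h3
      rw [h4]
      have h5 : (1 : ℝ) ≤ 2 ^ k := one_le_pow₀ (by norm_num)
      have h6 : (2 : ℝ) ^ (k + 2) ≤ Real.exp 1 ^ (k + 2) := by
        gcongr; linarith [Real.exp_one_gt_d9]
      rw [← Real.exp_nat_mul, pow_add] at h6
      push_cast at h6
      rw [mul_one] at h6
      linarith
    refine (Nat.cast_le.2 h1).trans (h2.trans (le_of_eq ?_))
    rw [← Real.exp_nat_mul]
  · intro θ hθ
    have hex : ∃ θ' ∈ T, q θ' = q θ := ⟨θ, hθ, rfl⟩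
    refine ⟨rep (q θ), Finset.mem_image_of_mem _ (Finset.mem_filter.2 ⟨hq θ hθ, hex⟩), ?_⟩
    have h1 := (hrep (q θ) hex).2
    rw [EuclideanSpace.norm_eq]
    have h2 : ∀ i, ‖(θ - rep (q θ)) i‖ ^ 2 ≤ (δ / 2 ^ k) ^ 2 := by
      intro i
      have h3 : ⌊2 ^ k * ((rep (q θ) i - c i) / δ)⌋ = ⌊2 ^ k * ((θ i - c i) / δ)⌋ := congrFun h1 i
      have h4 := Int.abs_sub_lt_one_of_floor_eq_floor h3.symm
      rw [PiLp.sub_apply]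
      gcongr
      rw [Real.norm_eq_abs]
      have h5 : θ i - rep (q θ) i = (δ / 2 ^ k) * (2 ^ k * ((θ i - c i) / δ) -
          2 ^ k * ((rep (q θ) i - c i) / δ)) := by field_simp; ring
      rw [h5, abs_mul, abs_of_pos (by positivity)]
      exact mul_le_of_le_one_right (by positivity) h4.le
    calc √(∑ i, ‖(θ - rep (q θ)) i‖ ^ 2) ≤ √(∑ _i : Fin d, (δ / 2 ^ k) ^ 2) :=
          Real.sqrt_le_sqrt (Finset.sum_le_sum fun i _ => h2 i)
      _ = √d * (δ / 2 ^ k) := by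
          rw [Finset.sum_const, Finset.card_univ, Fintype.card_fin, nsmul_eq_mul,
            Real.sqrt_mul (by positivity), Real.sqrt_sq (by positivity)]

/-- The constant of the chaining bound in dimension `d`. -/
noncomputable def chainingConst (d : ℕ) : ℝ := 2 * (√d + 1) * (14 * d + 8)

theorem chainingConst_pos (d : ℕ) : 0 < chainingConst d := by
  unfold chainingConst; positivity

theorem sum_chaining_weights (d K : ℕ) :
    ∑ k ∈ Finset.range K, ((d : ℝ) * (2 * k + 5) + 4) / 2 ^ k =
      14 * d + 8 - (d * (4 * K + 14) + 8) / 2 ^ K := by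
  induction K with
  | zero => simp; ring
  | succ K ih =>
    rw [Finset.sum_range_succ, ih, pow_succ]
    push_cast
    field_simp
    ring

/-- Chaining: if the coordinates of `a θ` are Lipschitz in `θ`, then the supremum over a set `T`
in a ball of radius `δ` of the signed sums of `a θ - a c` is, on average over the signs, of the
order of `δ` times the length of the vector of Lipschitz constants. The increments are summed along
nets of mesh `δ / 2 ^ k`. -/
theorem sum_iSup_signedSum_le {d n : ℕ} {T : Set (EuclideanSpace ℝ (Fin d))}
    {c : EuclideanSpace ℝ (Fin d)} {δ : ℝ} (hδ : 0 < δ) (hT : ∀ θ ∈ T, ‖θ - c‖ ≤ δ) (hc : c ∈ T)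
    (a : EuclideanSpace ℝ (Fin d) → Fin n → ℝ) (L : Fin n → ℝ) (hL : ∀ i, 0 ≤ L i)
    (ha : ∀ θ ∈ T, ∀ θ' ∈ T, ∀ i, |a θ i - a θ' i| ≤ L i * ‖θ - θ'‖) :
    ∑ σ : Fin n → Bool, ⨆ θ ∈ T, ENNReal.ofReal |signedSum σ (a θ - a c)| ≤
      ENNReal.ofReal (2 ^ n * (chainingConst d * δ * √(∑ i, L i ^ 2))) := by
  classical
  set Λ := √(∑ i, L i ^ 2) with hΛ
  set A : ℝ := √d + 1 with hA
  have hA0 : 0 ≤ √(d : ℝ) := Real.sqrt_nonneg _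
  have hApos : 0 < A := by positivity
  have hΛ2 : Λ ^ 2 = ∑ i, L i ^ 2 := Real.sq_sqrt (Finset.sum_nonneg fun i _ => sq_nonneg _)
  -- the net of level `0` is the centre alone
  have hnet : ∀ k : ℕ, ∃ F : Finset (EuclideanSpace ℝ (Fin d)), (∀ θ ∈ F, θ ∈ T) ∧
      (F.card : ℝ) ≤ Real.exp (d * (k + 2)) ∧
      (∀ θ ∈ T, ∃ θ' ∈ F, ‖θ - θ'‖ ≤ A * (δ / 2 ^ k)) ∧ (k = 0 → F = {c}) := by
    intro k
    rcases Nat.eq_zero_or_pos k with rfl | hk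
    · refine ⟨{c}, by simpa using hc, ?_, fun θ hθ => ⟨c, by simp, ?_⟩, fun _ => rfl⟩
      · simp only [Finset.card_singleton, Nat.cast_one]
        exact Real.one_le_exp (by positivity)
      · have := hT θ hθ
        simp only [pow_zero, div_one]
        nlinarith
    · obtain ⟨F, h1, h2, h3⟩ := exists_finset_net hδ hT k
      refine ⟨F, h1, h2, fun θ hθ => ?_, fun h => absurd h hk.ne'⟩
      obtain ⟨θ', h4, h5⟩ := h3 θ hθ
      refine ⟨θ', h4, h5.trans ?_⟩
      gcongr
      linarith
  choose F hFT hFcard hFnet hF0 using hnet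
  choose! π hπF hπ using hFnet
  -- the links between consecutive nets
  let J : ℕ → Finset (EuclideanSpace ℝ (Fin d) × EuclideanSpace ℝ (Fin d)) := fun k =>
    (F (k + 1) ×ˢ F k).filter fun z => ‖z.1 - z.2‖ ≤ 2 * A * (δ / 2 ^ k)
  have hB : ∀ k, ∃ B : (Fin n → Bool) → ℝ, (∀ σ, 0 ≤ B σ) ∧
      (∀ σ, ∀ z ∈ J k, |signedSum σ (a z.1 - a z.2)| ≤ B σ) ∧
      ∑ σ, B σ ≤ 2 ^ n * (2 * A * (δ / 2 ^ k) * Λ * ((d : ℝ) * (2 * k + 5) + 4)) := by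
    intro k
    refine exists_signedSum_majorant (J k) (fun z => a z.1 - a z.2) (by positivity) ?_
      (by positivity) ?_
    · intro z hz
      obtain ⟨hz1, hz2⟩ := Finset.mem_filter.1 hz
      obtain ⟨hz3, hz4⟩ := Finset.mem_product.1 hz1
      rw [mul_pow, hΛ2, Finset.mul_sum]
      refine Finset.sum_le_sum fun i _ => ?_
      rw [← mul_pow, ← sq_abs]
      have h1 := ha z.1 (hFT _ _ hz3) z.2 (hFT _ _ hz4) i
      have h2 := mul_le_mul_of_nonneg_left hz2 (hL i)
      simp only [Pi.sub_apply]
      refine pow_le_pow_left₀ (abs_nonneg _) (by linarith) 2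
    · have h1 : ((J k).card : ℝ) ≤ (F (k + 1)).card * (F k).card := by
        rw [← Nat.cast_mul, ← Finset.card_product]
        exact Nat.cast_le.2 (Finset.card_filter_le _ _)
      have h2 := mul_le_mul (hFcard (k + 1)) (hFcard k) (by positivity) (Real.exp_pos _).le
      rw [← Real.exp_add] at h2
      refine h1.trans (h2.trans (Real.exp_le_exp.2 (le_of_eq ?_)))
      push_cast
      ring
  choose B hB0 hBJ hBsum using hB
  have key : ∀ K : ℕ, ∑ σ : Fin n → Bool, ⨆ θ ∈ T, ENNReal.ofReal |signedSum σ (a θ - a c)| ≤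
      ENNReal.ofReal (2 ^ n * (chainingConst d * δ * Λ) +
        2 ^ n * ((∑ i, L i) * (A * δ)) * (1 / 2) ^ K) := by
    intro K
    have hR : 0 ≤ (∑ i, L i) * (A * (δ / 2 ^ K)) :=
      mul_nonneg (Finset.sum_nonneg fun i _ => hL i) (by positivity)
    have h1 : ∀ σ : Fin n → Bool, ⨆ θ ∈ T, ENNReal.ofReal |signedSum σ (a θ - a c)| ≤
        ENNReal.ofReal (∑ k ∈ Finset.range K, B k σ + (∑ i, L i) * (A * (δ / 2 ^ K))) := by
      intro σ
      refine iSup₂_le fun θ hθ => ENNReal.ofReal_le_ofReal ?_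
      have h2 : ∀ k, |signedSum σ (a (π k θ) - a c)| ≤ ∑ j ∈ Finset.range k, B j σ := by
        intro k
        induction k with
        | zero =>
          have : π 0 θ = c := by simpa [hF0 0 rfl] using hπF 0 θ hθ
          simp [this, signedSum]
        | succ k ih =>
          rw [Finset.sum_range_succ]
          have h3 : signedSum σ (a (π (k + 1) θ) - a c) =
              signedSum σ (a (π k θ) - a c) + signedSum σ (a (π (k + 1) θ) - a (π k θ)) := by
            simp only [signedSum_sub]; ring
          rw [h3]
          refine (abs_add_le _ _).trans (add_le_add ih (hBJ k σ (π (k + 1) θ, π k θ) ?_))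
          refine Finset.mem_filter.2 ⟨Finset.mem_product.2 ⟨hπF _ θ hθ, hπF _ θ hθ⟩, ?_⟩
          have h4 := hπ (k + 1) θ hθ
          have h5 := hπ k θ hθ
          have h6 : ‖π (k + 1) θ - π k θ‖ ≤ ‖θ - π (k + 1) θ‖ + ‖θ - π k θ‖ := by
            have := norm_sub_le (θ - π k θ) (θ - π (k + 1) θ)
            rw [sub_sub_sub_cancel_left] at this
            linarith
          have h7 : A * (δ / 2 ^ (k + 1)) ≤ A * (δ / 2 ^ k) := by
            gcongr
            · norm_num
            · omega
          simp only
          linarith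
      have h3 : signedSum σ (a θ - a c) =
          signedSum σ (a (π K θ) - a c) + signedSum σ (a θ - a (π K θ)) := by
        simp only [signedSum_sub]; ring
      rw [h3]
      refine (abs_add_le _ _).trans (add_le_add (h2 K) ?_)
      refine (abs_signedSum_le _ _).trans ?_
      rw [Finset.sum_mul]
      refine Finset.sum_le_sum fun i _ => ?_
      exact (ha θ hθ _ (hFT _ _ (hπF K θ hθ)) i).trans
        (mul_le_mul_of_nonneg_left (hπ K θ hθ) (hL i))
    refine (Finset.sum_le_sum fun σ _ => h1 σ).trans ?_
    rw [← ENNReal.ofReal_sum_of_nonneg fun σ _ =>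
      add_nonneg (Finset.sum_nonneg fun k _ => hB0 k σ) hR]
    refine ENNReal.ofReal_le_ofReal ?_
    rw [Finset.sum_add_distrib, Finset.sum_comm]
    have h2 : ∑ k ∈ Finset.range K, ∑ σ, B k σ ≤ 2 ^ n * (chainingConst d * δ * Λ) := by
      calc ∑ k ∈ Finset.range K, ∑ σ, B k σ
          ≤ ∑ k ∈ Finset.range K,
            2 ^ n * (2 * A * (δ / 2 ^ k) * Λ * ((d : ℝ) * (2 * k + 5) + 4)) :=
            Finset.sum_le_sum fun k _ => hBsum k
        _ = 2 ^ n * (2 * A * δ * Λ) *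
            ∑ k ∈ Finset.range K, ((d : ℝ) * (2 * k + 5) + 4) / 2 ^ k := by
            rw [Finset.mul_sum]
            exact Finset.sum_congr rfl fun k _ => by ring
        _ ≤ 2 ^ n * (2 * A * δ * Λ) * (14 * d + 8) := by
            gcongr
            rw [sum_chaining_weights]
            have : (0 : ℝ) ≤ (d * (4 * K + 14) + 8) / 2 ^ K := by positivity
            linarith
        _ = _ := by rw [chainingConst, ← hA]; ring
    refine add_le_add h2 (le_of_eq ?_)
    simp only [Finset.sum_const, Finset.card_univ, Fintype.card_pi, Fintype.card_bool,
      Finset.prod_const, Fintype.card_fin, nsmul_eq_mul]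
    push_cast
    rw [one_div, inv_pow]
    ring
  refine ge_of_tendsto' (x := Filter.atTop) (ENNReal.tendsto_ofReal ?_) key
  have := (tendsto_pow_atTop_nhds_zero_of_lt_one (r := (1 / 2 : ℝ)) (by norm_num)
    (by norm_num)).const_mul (2 ^ n * ((∑ i, L i) * (A * δ)))
  simpa using this.const_add (2 ^ n * (chainingConst d * δ * Λ))

/-! ### Symmetrization and a maximal inequality for Lipschitz classes -/

/-- The maximal inequality for the empirical process indexed by a class of functions that is
Lipschitz in a parameter, with square integrable Lipschitz constant `L`. The expectation is first
replaced by an average over an independent copy of the sample; the law of the resulting differences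
is invariant under exchanging the two copies in any set of coordinates, so that
`sum_iSup_signedSum_le` applies. -/
theorem lintegral_iSup_empirical_le {W : Type*} [MeasurableSpace W] {ν : Measure W}
    [IsProbabilityMeasure ν] {d : ℕ} {T : Set (EuclideanSpace ℝ (Fin d))} (hTc : T.Countable)
    {c : EuclideanSpace ℝ (Fin d)} {δ : ℝ} (hδ : 0 < δ) (hT : ∀ θ ∈ T, ‖θ - c‖ ≤ δ) (hc : c ∈ T)
    {f : EuclideanSpace ℝ (Fin d) → W → ℝ} (hf : ∀ θ, Measurable (f θ))
    (hint : ∀ θ ∈ T, Integrable (f θ) ν) {L : W → ℝ} (hL0 : ∀ v, 0 ≤ L v)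
    (hL : MemLp L 2 ν) {κ : ℝ} (hκ : 0 < κ) (hLκ : ∫ v, L v ^ 2 ∂ν ≤ κ ^ 2)
    (hlip : ∀ᵐ v ∂ν, ∀ θ ∈ T, ∀ θ' ∈ T, |f θ v - f θ' v| ≤ L v * ‖θ - θ'‖)
    {n : ℕ} (hn : 1 ≤ n) :
    ∫⁻ z : Fin n → W, ⨆ θ ∈ T, ENNReal.ofReal
      |∑ i, (f θ (z i) - f c (z i)) - n * (∫ v, f θ v ∂ν - ∫ v, f c v ∂ν)|
        ∂(Measure.pi fun _ => ν) ≤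
      ENNReal.ofReal (chainingConst d * δ * (2 * √n * κ)) := by
  classical
  set ν' : Measure (Fin n → W) := Measure.pi fun _ => ν with hν'
  set ν₂ : Measure (Fin n → W × W) := Measure.pi fun _ => ν.prod ν with hν₂
  let G : (Fin n → W × W) → ℝ≥0∞ := fun z => ⨆ θ ∈ T, ENNReal.ofReal
    |∑ i, ((f θ (z i).1 - f c (z i).1) - (f θ (z i).2 - f c (z i).2))|
  have hGm : Measurable G := by
    refine Measurable.biSup T hTc fun θ _ => ?_
    have := hf θ
    have := hf c
    fun_prop
  let F : (Fin n → W) × (Fin n → W) → ℝ≥0∞ := fun z => ⨆ θ ∈ T, ENNReal.ofReal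
    |∑ i, ((f θ (z.1 i) - f c (z.1 i)) - (f θ (z.2 i) - f c (z.2 i)))|
  have hFm : Measurable F := by
    refine Measurable.biSup T hTc fun θ _ => ?_
    have := hf θ
    have := hf c
    fun_prop
  have step1 : ∀ z : Fin n → W, (⨆ θ ∈ T, ENNReal.ofReal
      |∑ i, (f θ (z i) - f c (z i)) - n * (∫ v, f θ v ∂ν - ∫ v, f c v ∂ν)|) ≤
      ∫⁻ z', F (z, z') ∂ν' := by
    intro z
    refine iSup₂_le fun θ hθ => ?_
    have hi : ∀ i : Fin n, Integrable (fun z' : Fin n → W => f θ (z' i) - f c (z' i)) ν' := fun i =>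
      integrable_comp_eval (μ := fun _ : Fin n => ν) (f := fun v => f θ v - f c v)
        ((hint θ hθ).sub (hint c hc))
    have h1 : ∑ i, (f θ (z i) - f c (z i)) - n * (∫ v, f θ v ∂ν - ∫ v, f c v ∂ν) =
        ∫ z', ∑ i, ((f θ (z i) - f c (z i)) - (f θ (z' i) - f c (z' i))) ∂ν' := by
      have hi' : ∀ i : Fin n, Integrable
          (fun z' => (f θ (z i) - f c (z i)) - (f θ (z' i) - f c (z' i))) ν' :=
        fun i => (integrable_const _).sub (hi i)
      rw [integral_finsetSum _ fun i _ => hi' i]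
      have h2 : ∀ i : Fin n, ∫ z', ((f θ (z i) - f c (z i)) - (f θ (z' i) - f c (z' i))) ∂ν' =
          (f θ (z i) - f c (z i)) - (∫ v, f θ v ∂ν - ∫ v, f c v ∂ν) := by
        intro i
        rw [integral_sub (integrable_const _) (hi i)]
        rw [integral_const, probReal_univ, one_smul, ← integral_sub (hint θ hθ) (hint c hc)]
        congr 1
        exact integral_comp_eval (μ := fun _ : Fin n => ν) (f := fun v => f θ v - f c v)
          ((hf θ).sub (hf c)).aestronglyMeasurable
      simp_rw [h2]
      simp [Finset.sum_sub_distrib, mul_sub]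
    rw [h1, ← Real.enorm_eq_ofReal_abs]
    refine (enorm_integral_le_lintegral_enorm _).trans (lintegral_mono fun z' => ?_)
    rw [Real.enorm_eq_ofReal_abs]
    exact le_iSup₂ (f := fun θ (_ : θ ∈ T) => ENNReal.ofReal
      |∑ i, ((f θ (z i) - f c (z i)) - (f θ (z' i) - f c (z' i)))|) θ hθ
  have step2 : ∫⁻ z, ∫⁻ z', F (z, z') ∂ν' ∂ν' = ∫⁻ z, G z ∂ν₂ := by
    rw [← lintegral_prod _ hFm.aemeasurable]
    exact ((measurePreserving_arrowProdEquivProdArrow W W (Fin n) (fun _ => ν)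
      fun _ => ν).lintegral_comp hFm).symm
  let a : (Fin n → W × W) → EuclideanSpace ℝ (Fin d) → Fin n → ℝ :=
    fun z θ i => f θ (z i).1 - f θ (z i).2
  have step3 : ∀ σ : Fin n → Bool, ∫⁻ z, G z ∂ν₂ =
      ∫⁻ z, (⨆ θ ∈ T, ENNReal.ofReal |signedSum σ (a z θ - a z c)|) ∂ν₂ := by
    intro σ
    let ψ : Bool → W × W → W × W := fun b v => cond b v v.swap
    have hψ : ∀ b, MeasurePreserving (ψ b) (ν.prod ν) (ν.prod ν) := by
      rintro (_ | _)
      · exact Measure.measurePreserving_swap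
      · exact MeasurePreserving.id _
    have hpres : MeasurePreserving (fun (z : Fin n → W × W) i => ψ (σ i) (z i)) ν₂ ν₂ :=
      measurePreserving_pi (fun _ => ν.prod ν) (fun _ => ν.prod ν) fun i => hψ (σ i)
    rw [← hpres.lintegral_comp hGm]
    refine lintegral_congr fun z => ?_
    refine iSup_congr fun θ => iSup_congr fun _ => ?_
    congr 2
    refine Finset.sum_congr rfl fun i _ => ?_
    simp only [a, ψ, Pi.sub_apply]
    cases σ i <;> simp <;> ring
  have hmeas3 : ∀ σ : Fin n → Bool, Measurable fun z : Fin n → W × W =>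
      ⨆ θ ∈ T, ENNReal.ofReal |signedSum σ (a z θ - a z c)| := by
    intro σ
    refine Measurable.biSup T hTc fun θ _ => ?_
    have := hf θ
    have := hf c
    simp only [signedSum, a, Pi.sub_apply]
    fun_prop
  set t : ℝ := 2 * √n * κ with ht
  have hn' : (0 : ℝ) < n := by exact_mod_cast hn
  have ht0 : 0 < t := by positivity
  have htsq : t ^ 2 = 4 * n * κ ^ 2 := by
    rw [ht, mul_pow, mul_pow, Real.sq_sqrt hn'.le]; ring
  let Q : (Fin n → W × W) → ℝ := fun z => ∑ i, (2 * L (z i).1 ^ 2 + 2 * L (z i).2 ^ 2)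
  have hQ0 : ∀ z, 0 ≤ Q z := fun z => Finset.sum_nonneg fun i _ => by positivity
  have hq1 : Integrable (fun v : W × W => 2 * L v.1 ^ 2 + 2 * L v.2 ^ 2) (ν.prod ν) :=
    ((hL.integrable_sq.comp_fst ν).const_mul 2).add ((hL.integrable_sq.comp_snd ν).const_mul 2)
  have hqi : ∀ i : Fin n,
      Integrable (fun z : Fin n → W × W => 2 * L (z i).1 ^ 2 + 2 * L (z i).2 ^ 2) ν₂ := fun i =>
    integrable_comp_eval (μ := fun _ : Fin n => ν.prod ν)
      (f := fun v => 2 * L v.1 ^ 2 + 2 * L v.2 ^ 2) hq1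
  have hQi : Integrable Q ν₂ := integrable_finsetSum _ fun i _ => hqi i
  have hQint : ∫ z, Q z ∂ν₂ ≤ t ^ 2 := by
    have h1 : ∀ i : Fin n, ∫ z, (2 * L (z i).1 ^ 2 + 2 * L (z i).2 ^ 2) ∂ν₂ =
        4 * ∫ v, L v ^ 2 ∂ν := by
      intro i
      rw [integral_comp_eval (μ := fun _ : Fin n => ν.prod ν)
        (f := fun v => 2 * L v.1 ^ 2 + 2 * L v.2 ^ 2) hq1.aestronglyMeasurable,
        integral_add ((hL.integrable_sq.comp_fst ν).const_mul 2)
          ((hL.integrable_sq.comp_snd ν).const_mul 2), integral_const_mul, integral_const_mul,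
        integral_fun_fst (fun v => L v ^ 2), integral_fun_snd (fun v => L v ^ 2)]
      simp
      ring
    simp only [Q]
    rw [integral_finsetSum _ fun i _ => hqi i]
    simp_rw [h1]
    rw [Finset.sum_const, Finset.card_univ, Fintype.card_fin, nsmul_eq_mul, htsq]
    nlinarith
  have hC := chainingConst_pos d
  have hae : ∀ᵐ z ∂ν₂, ∀ i : Fin n, ∀ θ ∈ T, ∀ θ' ∈ T,
      |f θ (z i).1 - f θ' (z i).1| ≤ L (z i).1 * ‖θ - θ'‖ ∧
      |f θ (z i).2 - f θ' (z i).2| ≤ L (z i).2 * ‖θ - θ'‖ := by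
    refine ae_all_iff.2 fun i => ?_
    have h1 : ∀ᵐ v ∂(ν.prod ν), ∀ θ ∈ T, ∀ θ' ∈ T,
        |f θ v.1 - f θ' v.1| ≤ L v.1 * ‖θ - θ'‖ ∧ |f θ v.2 - f θ' v.2| ≤ L v.2 * ‖θ - θ'‖ := by
      have h2 := Measure.quasiMeasurePreserving_fst (μ := ν) (ν := ν) |>.ae hlip
      have h3 := Measure.quasiMeasurePreserving_snd (μ := ν) (ν := ν) |>.ae hlip
      filter_upwards [h2, h3] with v hv1 hv2 θ hθ θ' hθ'
      exact ⟨hv1 θ hθ θ' hθ', hv2 θ hθ θ' hθ'⟩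
    exact (measurePreserving_eval (fun _ : Fin n => ν.prod ν) i).quasiMeasurePreserving.ae h1
  -- the square root is linearized by `√q ≤ (t + q / t) / 2`
  have step4 : ∀ᵐ z ∂ν₂, ∑ σ : Fin n → Bool,
      (⨆ θ ∈ T, ENNReal.ofReal |signedSum σ (a z θ - a z c)|) ≤
      ENNReal.ofReal (2 ^ n * (chainingConst d * δ) * ((t + Q z / t) / 2)) := by
    filter_upwards [hae] with z hz
    refine (sum_iSup_signedSum_le hδ hT hc (a z) (fun i => L (z i).1 + L (z i).2)
      (fun i => add_nonneg (hL0 _) (hL0 _)) fun θ hθ θ' hθ' i => ?_).trans ?_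
    · have h1 := (hz i θ hθ θ' hθ').1
      have h2 := (hz i θ hθ θ' hθ').2
      have h3 : a z θ i - a z θ' i =
        (f θ (z i).1 - f θ' (z i).1) - (f θ (z i).2 - f θ' (z i).2) := by simp only [a]; ring
      rw [h3]
      refine (abs_sub _ _).trans ?_
      linarith
    · refine ENNReal.ofReal_le_ofReal ?_
      rw [← mul_assoc]
      gcongr
      have h1 : ∑ i, (L (z i).1 + L (z i).2) ^ 2 ≤ Q z :=
        Finset.sum_le_sum fun i _ => by nlinarith [sq_nonneg (L (z i).1 - L (z i).2)]
      have h2 := Real.sqrt_le_sqrt h1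
      refine h2.trans ?_
      have h3 := Real.sq_sqrt (hQ0 z)
      have h4 : (t + Q z / t) / 2 - √(Q z) = (t - √(Q z)) ^ 2 / (2 * t) := by
        field_simp
        nlinarith
      have h5 : 0 ≤ (t - √(Q z)) ^ 2 / (2 * t) := by positivity
      linarith
  have step5 : (2 : ℝ≥0∞) ^ n * ∫⁻ z, G z ∂ν₂ ≤
      2 ^ n * ENNReal.ofReal (chainingConst d * δ * t) := by
    calc (2 : ℝ≥0∞) ^ n * ∫⁻ z, G z ∂ν₂ = ∑ _σ : Fin n → Bool, ∫⁻ z, G z ∂ν₂ := by simp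
      _ = ∑ σ : Fin n → Bool,
          ∫⁻ z, (⨆ θ ∈ T, ENNReal.ofReal |signedSum σ (a z θ - a z c)|) ∂ν₂ :=
          Finset.sum_congr rfl fun σ _ => step3 σ
      _ = ∫⁻ z, ∑ σ : Fin n → Bool,
          (⨆ θ ∈ T, ENNReal.ofReal |signedSum σ (a z θ - a z c)|) ∂ν₂ :=
          (lintegral_finsetSum _ fun σ _ => hmeas3 σ).symm
      _ ≤ ∫⁻ z, ENNReal.ofReal (2 ^ n * (chainingConst d * δ) * ((t + Q z / t) / 2)) ∂ν₂ :=
          lintegral_mono_ae step4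
      _ = ENNReal.ofReal
          (∫ z, 2 ^ n * (chainingConst d * δ) * ((t + Q z / t) / 2) ∂ν₂) := by
          refine (ofReal_integral_eq_lintegral_ofReal ?_ (ae_of_all _ fun z => ?_)).symm
          · exact (((integrable_const t).add (hQi.div_const t)).div_const 2).const_mul _
          · have := hQ0 z
            change 0 ≤ 2 ^ n * (chainingConst d * δ) * ((t + Q z / t) / 2)
            positivity
      _ ≤ ENNReal.ofReal (2 ^ n * (chainingConst d * δ * t)) := by
          refine ENNReal.ofReal_le_ofReal ?_
          rw [integral_const_mul, integral_div, integral_add (integrable_const t)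
            (hQi.div_const t), integral_div, integral_const, probReal_univ, one_smul,
            mul_assoc (2 ^ n)]
          refine mul_le_mul_of_nonneg_left (mul_le_mul_of_nonneg_left ?_ (by positivity))
            (by positivity)
          have : (∫ z, Q z ∂ν₂) / t ≤ t := by
            rw [div_le_iff₀ ht0]; nlinarith
          linarith
      _ = 2 ^ n * ENNReal.ofReal (chainingConst d * δ * t) := by
          rw [ENNReal.ofReal_mul (by positivity), ENNReal.ofReal_pow (by norm_num)]
          norm_num
  calc _ ≤ ∫⁻ z, ∫⁻ z', F (z, z') ∂ν' ∂ν' := lintegral_mono step1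
    _ = ∫⁻ z, G z ∂ν₂ := step2
    _ ≤ _ := by
      have h2 : (2 : ℝ≥0∞) ^ n ≠ 0 := by positivity
      exact (ENNReal.mul_le_mul_iff_right h2 (by simp)).1 step5

/-! ### The rate of convergence of minimizers of Lipschitz criteria -/

theorem continuousOn_of_abs_sub_le {E : Type*} [SeminormedAddCommGroup E] {U : Set E} {F : E → ℝ}
    {K : ℝ} (h : ∀ θ ∈ U, ∀ θ' ∈ U, |F θ - F θ'| ≤ K * ‖θ - θ'‖) : ContinuousOn F U := by
  refine (LipschitzOnWith.of_dist_le_mul (K := K.toNNReal) fun θ hθ θ' hθ' => ?_).continuousOn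
  rw [Real.dist_eq, dist_eq_norm]
  exact (h θ hθ θ' hθ').trans (mul_le_mul_of_nonneg_right (Real.le_coe_toNNReal K) (norm_nonneg _))

/-- A strict inequality that a function continuous on `U` satisfies somewhere in `U` holds somewhere
in every subset that is dense in `U`. -/
theorem ContinuousOn.exists_mem_lt_of_dense {E : Type*} [TopologicalSpace E] {U D : Set E}
    (hDU : D ⊆ U) (hUD : U ⊆ closure D) {F : E → ℝ} (hF : ContinuousOn F U) {θ : E} (hθ : θ ∈ U)
    {t : ℝ} (ht : t < F θ) : ∃ θ' ∈ D, t < F θ' := by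
  have h1 : ∀ᶠ θ' in nhdsWithin θ D, t < F θ' :=
    ((hF θ hθ).mono_left (nhdsWithin_mono _ hDU)).eventually (lt_mem_nhds ht)
  have : (nhdsWithin θ D).NeBot := mem_closure_iff_nhdsWithin_neBot.1 (hUD hθ)
  obtain ⟨θ', h2, h3⟩ := (h1.and self_mem_nhdsWithin).exists
  exact ⟨θ', h3, h2⟩

/-- Tail bound for the centred sums over a ball of radius `δ` around `c`. By continuity in the
parameter the supremum may be taken over a countable dense set. -/
theorem measure_exists_empirical_gt_le {W S : Type*} [MeasurableSpace W] [MeasurableSpace S]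
    {ν : Measure W} [IsProbabilityMeasure ν] {P : Measure S} [IsProbabilityMeasure P]
    {d : ℕ} {Θ : Set (EuclideanSpace ℝ (Fin d))} {c : EuclideanSpace ℝ (Fin d)} (hc : c ∈ Θ)
    {f : EuclideanSpace ℝ (Fin d) → W → ℝ} (hf : ∀ θ, Measurable (f θ))
    (hint : ∀ θ ∈ Θ, Integrable (f θ) ν) {L : W → ℝ} (hL0 : ∀ v, 0 ≤ L v)
    (hL : MemLp L 2 ν) {κ : ℝ} (hκ : 0 < κ) (hLκ : ∫ v, L v ^ 2 ∂ν ≤ κ ^ 2)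
    (hlip : ∀ᵐ v ∂ν, ∀ θ ∈ Θ, ∀ θ' ∈ Θ, |f θ v - f θ' v| ≤ L v * ‖θ - θ'‖)
    {w : ℕ → S → W} (hw : ∀ j, Measurable (w j)) (hlaw : ∀ j, P.map (w j) = ν)
    (hiid : iIndepFun w P) {n : ℕ} (hn : 1 ≤ n) {δ t : ℝ} (hδ : 0 < δ) (ht : 0 < t) :
    P {s | ∃ θ ∈ Θ, ‖θ - c‖ ≤ δ ∧ t < |∑ j ∈ Finset.range n, (f θ (w j s) - f c (w j s)) -
      n * (∫ v, f θ v ∂ν - ∫ v, f c v ∂ν)|} ≤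
      ENNReal.ofReal (chainingConst d * δ * (2 * √n * κ) / t) := by
  set U : Set (EuclideanSpace ℝ (Fin d)) := {θ | θ ∈ Θ ∧ ‖θ - c‖ ≤ δ} with hU
  obtain ⟨D, hDU, hDc, hUD⟩ :=
    (TopologicalSpace.IsSeparable.of_separableSpace U).exists_countable_dense_subset
  have hcU : c ∈ U := ⟨hc, by simpa using hδ.le⟩
  set T := insert c D with hT
  have hTU : T ⊆ U := Set.insert_subset hcU hDU
  have hTc : T.Countable := hDc.insert c
  let G : (Fin n → W) → ℝ≥0∞ := fun z => ⨆ θ ∈ T, ENNReal.ofReal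
      |∑ i, (f θ (z i) - f c (z i)) - n * (∫ v, f θ v ∂ν - ∫ v, f c v ∂ν)|
  have hGm : Measurable G := by
    refine Measurable.biSup T hTc fun θ _ => ?_
    have := hf θ
    have := hf c
    fun_prop
  have hG := lintegral_iSup_empirical_le (ν := ν) hTc hδ (fun θ hθ => (hTU hθ).2)
    (Set.mem_insert c D) hf (fun θ hθ => hint θ (hTU hθ).1) hL0 hL hκ hLκ
    (hlip.mono fun v hv θ hθ θ' hθ' => hv θ (hTU hθ).1 θ' (hTU hθ').1) hn
  have hmap : P.map (fun s (i : Fin n) => w i s) = Measure.pi fun _ => ν := by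
    have h1 : iIndepFun (fun i : Fin n => w i) P := hiid.precomp Fin.val_injective
    rw [(iIndepFun_iff_map_fun_eq_pi_map fun i : Fin n => (hw i).aemeasurable).1 h1]
    simp_rw [hlaw]
  have hwm : Measurable (fun s (i : Fin n) => w i s) := measurable_pi_lambda _ fun i => hw i
  have hLi : Integrable L ν := hL.integrable one_le_two
  have hlipw : ∀ᵐ s ∂P, ∀ j, ∀ θ ∈ Θ, ∀ θ' ∈ Θ,
      |f θ (w j s) - f θ' (w j s)| ≤ L (w j s) * ‖θ - θ'‖ := by
    refine ae_all_iff.2 fun j => ?_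
    have := hlip
    rw [← hlaw j] at this
    exact ae_of_ae_map (hw j).aemeasurable this
  have hmeanlip : ∀ θ ∈ Θ, ∀ θ' ∈ Θ,
      |∫ v, f θ v ∂ν - ∫ v, f θ' v ∂ν| ≤ (∫ v, L v ∂ν) * ‖θ - θ'‖ := by
    intro θ hθ θ' hθ'
    rw [← integral_sub (hint θ hθ) (hint θ' hθ'), ← integral_mul_const, ← Real.norm_eq_abs]
    refine norm_integral_le_of_norm_le (hLi.mul_const _) ?_
    filter_upwards [hlip] with v hv
    exact hv θ hθ θ' hθ'
  calc _ ≤ P ((fun s (i : Fin n) => w i s) ⁻¹' {z | ENNReal.ofReal t ≤ G z}) := by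
        refine measure_mono_ae ?_
        filter_upwards [hlipw] with s hs
        rintro ⟨θ, hθ, hθδ, hlt⟩
        have hcont : ContinuousOn (fun θ => |∑ j ∈ Finset.range n, (f θ (w j s) - f c (w j s)) -
            n * (∫ v, f θ v ∂ν - ∫ v, f c v ∂ν)|) U := by
          refine ContinuousOn.abs (ContinuousOn.sub (continuousOn_finsetSum _ fun j _ => ?_) ?_)
          · exact (continuousOn_of_abs_sub_le fun θ hθ θ' hθ' =>
              hs j θ hθ.1 θ' hθ'.1).sub continuousOn_const
          · exact continuousOn_const.mul ((continuousOn_of_abs_sub_le fun θ hθ θ' hθ' =>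
              hmeanlip θ hθ.1 θ' hθ'.1).sub continuousOn_const)
        obtain ⟨θ', hθ', hlt'⟩ := hcont.exists_mem_lt_of_dense hDU hUD ⟨hθ, hθδ⟩ hlt
        change ENNReal.ofReal t ≤ G fun i => w i s
        refine le_trans (ENNReal.ofReal_le_ofReal ?_) (le_iSup₂ (f := fun θ (_ : θ ∈ T) =>
          ENNReal.ofReal |∑ i : Fin n, (f θ (w i s) - f c (w i s)) -
            n * (∫ v, f θ v ∂ν - ∫ v, f c v ∂ν)|) θ' (Set.mem_insert_of_mem c hθ'))
        rw [Fin.sum_univ_eq_sum_range (fun j => f θ' (w j s) - f c (w j s)) n]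
        exact hlt'.le
    _ = (Measure.pi fun _ : Fin n => ν) {z | ENNReal.ofReal t ≤ G z} := by
        rw [← hmap, Measure.map_apply hwm (measurableSet_le measurable_const hGm)]
    _ ≤ (∫⁻ z, G z ∂(Measure.pi fun _ => ν)) / ENNReal.ofReal t :=
        meas_ge_le_lintegral_div hGm.aemeasurable (by simpa using ht) ENNReal.ofReal_ne_top
    _ ≤ ENNReal.ofReal (chainingConst d * δ * (2 * √n * κ)) / ENNReal.ofReal t := by
        gcongr
    _ = _ := (ENNReal.ofReal_div_of_pos ht).symm

/-- Minimizers over `Θ` of the sums of a criterion `f θ` that is Lipschitz in `θ`, with a square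
integrable constant, and whose mean grows quadratically around its minimizer `c`, converge to `c` at
the rate `n ^ (-1/2)`. The proof cuts `Θ` into the shells
`2 ^ j * K / √n ≤ ‖θ - c‖ < 2 ^ (j + 1) * K / √n`: the probability that the minimizer falls into the
`j`-th shell is of the order of `2 ^ (-j) / K`. -/
theorem isBigOInProbability_minimizer {W S : Type*} [MeasurableSpace W] [MeasurableSpace S]
    {ν : Measure W} [IsProbabilityMeasure ν] {P : Measure S} [IsProbabilityMeasure P]
    {d : ℕ} {Θ : Set (EuclideanSpace ℝ (Fin d))} {c : EuclideanSpace ℝ (Fin d)} (hc : c ∈ Θ)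
    {f : EuclideanSpace ℝ (Fin d) → W → ℝ} (hf : ∀ θ, Measurable (f θ))
    (hint : ∀ θ ∈ Θ, Integrable (f θ) ν) {L : W → ℝ} (hL0 : ∀ v, 0 ≤ L v)
    (hL : MemLp L 2 ν)
    (hlip : ∀ᵐ v ∂ν, ∀ θ ∈ Θ, ∀ θ' ∈ Θ, |f θ v - f θ' v| ≤ L v * ‖θ - θ'‖)
    {c₀ : ℝ} (hc₀ : 0 < c₀)
    (hgrow : ∀ θ ∈ Θ, ∫ v, f c v ∂ν + c₀ * ‖θ - c‖ ^ 2 ≤ ∫ v, f θ v ∂ν)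
    {w : ℕ → S → W} (hw : ∀ j, Measurable (w j)) (hlaw : ∀ j, P.map (w j) = ν)
    (hiid : iIndepFun w P) {θhat : ℕ → S → EuclideanSpace ℝ (Fin d)}
    (hmin : ∀ n, ∀ᵐ s ∂P, θhat n s ∈ Θ ∧ ∀ θ' ∈ Θ, ∑ j ∈ Finset.range n, f (θhat n s) (w j s) ≤
      ∑ j ∈ Finset.range n, f θ' (w j s)) :
    IsBigOInProbability P (fun n s => ‖θhat n s - c‖) (fun n => (√n)⁻¹) := by
  have hL2 : 0 ≤ ∫ v, L v ^ 2 ∂ν := integral_nonneg fun v => sq_nonneg _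
  set κ : ℝ := √(∫ v, L v ^ 2 ∂ν) + 1 with hκdef
  have hκ : 0 < κ := by positivity
  have hLκ : ∫ v, L v ^ 2 ∂ν ≤ κ ^ 2 := by
    nlinarith [Real.sq_sqrt hL2, Real.sqrt_nonneg (∫ v, L v ^ 2 ∂ν)]
  have hC := chainingConst_pos d
  intro ε hε
  -- chosen so that the geometric series of the shell probabilities sums to `ε`
  set K : ℝ := 16 * chainingConst d * κ / (c₀ * ε) with hK
  have hK0 : 0 < K := by positivity
  refine ⟨K, hK0, 1, fun n hn => ?_⟩
  have hn' : (0 : ℝ) < n := by exact_mod_cast hn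
  have hsn : 0 < √(n : ℝ) := Real.sqrt_pos.2 hn'
  let δ : ℕ → ℝ := fun j => 2 ^ (j + 1) * K / √n
  let t : ℕ → ℝ := fun j => c₀ * (2 ^ j * K) ^ 2 / 2
  calc P {s | K * (√n)⁻¹ < |‖θhat n s - c‖|}
      ≤ P (⋃ j, {s | ∃ θ ∈ Θ, ‖θ - c‖ ≤ δ j ∧
        t j < |∑ i ∈ Finset.range n, (f θ (w i s) - f c (w i s)) -
          n * (∫ v, f θ v ∂ν - ∫ v, f c v ∂ν)|}) := by
        refine measure_mono_ae ?_
        filter_upwards [hmin n] with s hs hlt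
        change K * (√n)⁻¹ < |‖θhat n s - c‖| at hlt
        rw [abs_of_nonneg (norm_nonneg _), ← div_eq_mul_inv, div_lt_iff₀ hsn] at hlt
        set u := ‖θhat n s - c‖ with hu
        obtain ⟨j, hj1, hj2⟩ := exists_nat_pow_near (x := u * √n / K) (y := 2)
          (by rw [one_le_div hK0]; exact hlt.le) one_lt_two
        rw [le_div_iff₀ hK0] at hj1
        rw [div_lt_iff₀ hK0] at hj2
        refine Set.mem_iUnion.2 ⟨j, θhat n s, hs.1, ?_, ?_⟩
        · rw [← hu, le_div_iff₀ hsn]; exact hj2.le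
        · have h1 := hs.2 c hc
          have h2 := hgrow _ hs.1
          rw [← hu] at h2
          have h3 : c₀ * (u * √n) ^ 2 ≤ n * (∫ v, f (θhat n s) v ∂ν - ∫ v, f c v ∂ν) := by
            rw [mul_pow, Real.sq_sqrt hn'.le]
            nlinarith
          have h4 : c₀ * (2 ^ j * K) ^ 2 ≤ c₀ * (u * √n) ^ 2 := by gcongr
          have h5 : 0 < c₀ * (2 ^ j * K) ^ 2 := by positivity
          rw [Finset.sum_sub_distrib, abs_sub_comm]
          refine lt_of_lt_of_le ?_ (le_abs_self _)
          change c₀ * (2 ^ j * K) ^ 2 / 2 < _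
          linarith
    _ ≤ ∑' j, P {s | ∃ θ ∈ Θ, ‖θ - c‖ ≤ δ j ∧
        t j < |∑ i ∈ Finset.range n, (f θ (w i s) - f c (w i s)) -
          n * (∫ v, f θ v ∂ν - ∫ v, f c v ∂ν)|} := measure_iUnion_le _
    _ ≤ ∑' j, ENNReal.ofReal (chainingConst d * δ j * (2 * √n * κ) / t j) :=
        ENNReal.tsum_le_tsum fun j => measure_exists_empirical_gt_le hc hf hint hL0 hL hκ hLκ hlip
          hw hlaw hiid hn (by positivity) (by positivity)
    _ = ∑' j : ℕ, ENNReal.ofReal (ε / 2 * (1 / 2) ^ j) := by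
        refine tsum_congr fun j => congrArg _ ?_
        simp only [δ, t, hK]
        rw [one_div, inv_pow]
        field_simp
        ring
    _ = ENNReal.ofReal ε := by
        rw [← ENNReal.ofReal_tsum_of_nonneg (fun j => by positivity)
          (summable_geometric_two.mul_left _), tsum_mul_left, tsum_geometric_two]
        congr 1
        ring

/-! ### Envelopes of the regression function and its gradient -/

/-- A family of functions that is continuous in the parameter and whose supremum has a finite
integral has a measurable integrable envelope: the supremum over a countable dense set of
parameters. -/
theorem exists_integrable_envelope {Ω W : Type*} [MeasurableSpace Ω] [MeasurableSpace W]
    {μ : Measure Ω} {Φ : Ω → W} (hΦ : Measurable Φ) {d : ℕ} {Θ : Set (EuclideanSpace ℝ (Fin d))}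
    {F : EuclideanSpace ℝ (Fin d) → W → ℝ} (hF : ∀ θ ∈ Θ, Measurable (F θ))
    (hcont : ∀ v, ContinuousOn (fun θ => F θ v) Θ)
    (hsup : ∫⁻ ω, ⨆ θ ∈ Θ, ENNReal.ofReal (F θ (Φ ω)) ∂μ < ∞) :
    ∃ B : W → ℝ, Measurable B ∧ (∀ v, 0 ≤ B v) ∧ Integrable B (μ.map Φ) ∧
      ∀ᵐ v ∂(μ.map Φ), ∀ θ ∈ Θ, F θ v ≤ B v := by
  obtain ⟨D, hDΘ, hDc, hΘD⟩ :=
    (TopologicalSpace.IsSeparable.of_separableSpace Θ).exists_countable_dense_subset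
  let B : W → ℝ≥0∞ := fun v => ⨆ θ ∈ D, ENNReal.ofReal (F θ v)
  have hB : Measurable B := Measurable.biSup D hDc fun θ hθ => (hF θ (hDΘ hθ)).ennreal_ofReal
  have hfin : ∫⁻ v, B v ∂(μ.map Φ) ≠ ∞ := by
    rw [lintegral_map hB hΦ]
    refine (lt_of_le_of_lt (lintegral_mono fun ω => ?_) hsup).ne
    exact biSup_mono fun θ hθ => hDΘ hθ
  refine ⟨fun v => (B v).toReal, hB.ennreal_toReal, fun v => ENNReal.toReal_nonneg,
    integrable_toReal_of_lintegral_ne_top hB.aemeasurable hfin, ?_⟩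
  filter_upwards [ae_lt_top hB hfin] with v hv θ hθ
  by_contra! hlt
  obtain ⟨θ', hθ', hlt'⟩ := (hcont v).exists_mem_lt_of_dense hDΘ hΘD hθ hlt
  have h1 : ENNReal.ofReal (F θ' v) ≤ B v :=
    le_iSup₂ (f := fun θ (_ : θ ∈ D) => ENNReal.ofReal (F θ v)) θ' hθ'
  exact absurd hlt' (not_lt.2 ((ENNReal.ofReal_le_iff_le_toReal hv.ne).1 h1))

theorem frobenius_norm_vecMulVec_self {d : ℕ} (a : Fin d → ℝ) :
    ‖Matrix.vecMulVec a a‖ = ∑ i, a i ^ 2 := by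
  have h : ∑ i, ∑ j, ‖Matrix.vecMulVec a a i j‖ ^ (2 : ℝ) = (∑ i, a i ^ 2) ^ 2 := by
    rw [sq, Finset.sum_mul_sum]
    refine Finset.sum_congr rfl fun i _ => Finset.sum_congr rfl fun j _ => ?_
    rw [Matrix.vecMulVec_apply, Real.rpow_two, Real.norm_eq_abs, sq_abs]
    ring
  rw [Matrix.frobenius_norm_def, h, ← Real.sqrt_eq_rpow,
    Real.sqrt_sq (Finset.sum_nonneg fun i _ => sq_nonneg _)]

section Gradient

variable {p d : ℕ} {g : EuclideanSpace ℝ (Fin p) → EuclideanSpace ℝ (Fin d) → ℝ}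
  {Θ : Set (EuclideanSpace ℝ (Fin d))}

theorem fderiv_apply_eq_sum_paramGrad (x : EuclideanSpace ℝ (Fin p))
    (θ u : EuclideanSpace ℝ (Fin d)) :
    fderiv ℝ (g x) θ u = ∑ i, paramGrad g x θ i * u i := by
  conv_lhs => rw [← (EuclideanSpace.basisFun (Fin d) ℝ).sum_repr u]
  rw [map_sum]
  refine Finset.sum_congr rfl fun i _ => ?_
  rw [map_smul, EuclideanSpace.basisFun_repr, EuclideanSpace.basisFun_apply, smul_eq_mul, mul_comm]
  rfl

theorem norm_fderiv_le_sqrt_sum_paramGrad (x : EuclideanSpace ℝ (Fin p))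
    (θ : EuclideanSpace ℝ (Fin d)) :
    ‖fderiv ℝ (g x) θ‖ ≤ √(∑ i, paramGrad g x θ i ^ 2) := by
  refine ContinuousLinearMap.opNorm_le_bound _ (Real.sqrt_nonneg _) fun u => ?_
  rw [fderiv_apply_eq_sum_paramGrad, Real.norm_eq_abs, EuclideanSpace.norm_eq,
    ← Real.sqrt_mul (Finset.sum_nonneg fun i _ => sq_nonneg _)]
  refine Real.abs_le_sqrt ?_
  simpa using Finset.sum_mul_sq_le_sq_mul_sq Finset.univ (paramGrad g x θ) u

theorem measurable_paramGrad (hg : ∀ θ, Measurable fun x => g x θ)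
    {θ : EuclideanSpace ℝ (Fin d)} (hd : ∀ x, DifferentiableAt ℝ (g x) θ) (i : Fin d) :
    Measurable fun x => paramGrad g x θ i := by
  refine measurable_of_tendsto_metrizable (f := fun (n : ℕ) x => (n : ℝ) •
    (g x (θ + (n : ℝ)⁻¹ • EuclideanSpace.single i 1) - g x θ)) (fun n => ?_) ?_
  · simp only [smul_eq_mul]
    exact ((hg _).sub (hg _)).const_mul (n : ℝ)
  · refine tendsto_pi_nhds.2 fun x => (hd x).hasFDerivAt.lim _ ?_
    simpa using tendsto_natCast_atTop_atTop

theorem continuousOn_paramGrad {x : EuclideanSpace ℝ (Fin p)}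
    (hg : ∀ θ ∈ Θ, ContDiffAt ℝ 2 (g x) θ) (i : Fin d) :
    ContinuousOn (fun θ => paramGrad g x θ i) Θ := by
  intro θ hθ
  have h1 : ContDiffAt ℝ 1 (fderiv ℝ (g x)) θ := (hg θ hθ).fderiv_right (by norm_num)
  exact (h1.continuousAt.clm_apply continuousAt_const).continuousWithinAt

end Gradient

theorem memLp_two_sqrt {W : Type*} [MeasurableSpace W] {ν : Measure W} {B : W → ℝ}
    (hB : Measurable B) (hB0 : ∀ v, 0 ≤ B v) (hint : Integrable B ν) :
    MemLp (fun v => √(B v)) 2 ν := by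
  rw [memLp_two_iff_integrable_sq hB.sqrt.aestronglyMeasurable]
  simpa only [Real.sq_sqrt (hB0 _)] using hint

/-- `Q`, `G` and `L` are square integrable majorants, under the law `ν` of `(X, Y)`, of the
regression function, of its gradient (and hence of its Lipschitz constant in the parameter) and of
the Lipschitz constant of the squared residual. -/
structure IsEnvelope {p d : ℕ} (ν : Measure (EuclideanSpace ℝ (Fin p) × ℝ))
    (g : EuclideanSpace ℝ (Fin p) → EuclideanSpace ℝ (Fin d) → ℝ)
    (Θ : Set (EuclideanSpace ℝ (Fin d))) (Q G L : EuclideanSpace ℝ (Fin p) × ℝ → ℝ) : Prop where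
  measurable_Q : Measurable Q
  measurable_G : Measurable G
  nonneg_L : ∀ v, 0 ≤ L v
  memLp_Q : MemLp Q 2 ν
  memLp_G : MemLp G 2 ν
  memLp_L : MemLp L 2 ν
  abs_le : ∀ᵐ v ∂ν, ∀ θ ∈ Θ, |g v.1 θ| ≤ Q v
  grad_le : ∀ᵐ v ∂ν, ∀ θ ∈ Θ, ∀ i, |paramGrad g v.1 θ i| ≤ G v
  lipschitz : ∀ᵐ v ∂ν, ∀ θ ∈ Θ, ∀ θ' ∈ Θ, |g v.1 θ - g v.1 θ'| ≤ G v * ‖θ - θ'‖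
  lipschitz_sq : ∀ᵐ v ∂ν, ∀ θ ∈ Θ, ∀ θ' ∈ Θ,
    |(v.2 - g v.1 θ) ^ 2 - (v.2 - g v.1 θ') ^ 2| ≤ L v * ‖θ - θ'‖

namespace RegularityConditions

variable {Ω : Type*} [MeasurableSpace Ω] {μ : Measure Ω} {p d : ℕ}
  {X : Ω → EuclideanSpace ℝ (Fin p)} {Y : Ω → ℝ}
  {g : EuclideanSpace ℝ (Fin p) → EuclideanSpace ℝ (Fin d) → ℝ}
  {Θ : Set (EuclideanSpace ℝ (Fin d))} {θs : EuclideanSpace ℝ (Fin d)}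

theorem differentiableAt (h : RegularityConditions μ X Y g Θ θs) (x : EuclideanSpace ℝ (Fin p))
    {θ : EuclideanSpace ℝ (Fin d)} (hθ : θ ∈ Θ) : DifferentiableAt ℝ (g x) θ :=
  (h.contDiff_g x θ hθ).differentiableAt (by norm_num)

theorem measurable_pair (h : RegularityConditions μ X Y g Θ θs) :
    Measurable fun ω => (X ω, Y ω) :=
  h.measurable_X.prodMk h.measurable_Y

theorem exists_isEnvelope (h : RegularityConditions μ X Y g Θ θs) :
    ∃ Q G L, IsEnvelope (μ.map fun ω => (X ω, Y ω)) g Θ Q G L := by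
  have hgm : ∀ θ, Measurable fun v : EuclideanSpace ℝ (Fin p) × ℝ => g v.1 θ := fun θ =>
    (h.measurable_g θ).comp measurable_fst
  have hgradm : ∀ θ ∈ Θ, ∀ i,
      Measurable fun v : EuclideanSpace ℝ (Fin p) × ℝ => paramGrad g v.1 θ i := fun θ hθ i =>
    (measurable_paramGrad h.measurable_g (fun x => h.differentiableAt x hθ) i).comp measurable_fst
  have hgc : ∀ x, ContinuousOn (g x) Θ := fun x θ hθ =>
    (h.differentiableAt x hθ).continuousAt.continuousWithinAt
  obtain ⟨B₁, hB₁, hB₁0, hB₁i, hB₁b⟩ := exists_integrable_envelope (Θ := Θ) (μ := μ)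
    h.measurable_pair (F := fun θ v => g v.1 θ ^ 2) (fun θ _ => (hgm θ).pow_const 2)
    (fun v => (hgc v.1).pow 2) h.sup_g
  have hsq : ∀ x, ContinuousOn (fun θ => ∑ i, paramGrad g x θ i ^ 2) Θ := fun x =>
    continuousOn_finsetSum _ fun i _ => (continuousOn_paramGrad (h.contDiff_g x) i).pow 2
  obtain ⟨B₂, hB₂, hB₂0, hB₂i, hB₂b⟩ := exists_integrable_envelope (Θ := Θ) (μ := μ)
    h.measurable_pair (F := fun θ v => ∑ i, paramGrad g v.1 θ i ^ 2)
    (fun θ hθ => Finset.measurable_sum _ fun i _ => (hgradm θ hθ i).pow_const 2)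
    (fun v => hsq v.1)
    (by simpa only [frobenius_norm_vecMulVec_self] using h.sup_grad)
  obtain ⟨B₃, hB₃, hB₃0, hB₃i, hB₃b⟩ := exists_integrable_envelope (Θ := Θ) (μ := μ)
    h.measurable_pair (F := fun θ v => (v.2 - g v.1 θ) ^ 2 * ∑ i, paramGrad g v.1 θ i ^ 2)
    (fun θ hθ => ((measurable_snd.sub (hgm θ)).pow_const 2).mul
      (Finset.measurable_sum _ fun i _ => (hgradm θ hθ i).pow_const 2))
    (fun v => ((continuousOn_const.sub (hgc v.1)).pow 2).mul (hsq v.1))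
    (by simpa only [norm_smul, frobenius_norm_vecMulVec_self, norm_pow, Real.norm_eq_abs, sq_abs]
          using h.sup_res_grad)
  refine ⟨fun v => √(B₁ v), fun v => √(B₂ v), fun v => 2 * √(B₃ v),
    { measurable_Q := hB₁.sqrt
      measurable_G := hB₂.sqrt
      nonneg_L := fun v => by positivity
      memLp_Q := memLp_two_sqrt hB₁ hB₁0 hB₁i
      memLp_G := memLp_two_sqrt hB₂ hB₂0 hB₂i
      memLp_L := (memLp_two_sqrt hB₃ hB₃0 hB₃i).const_mul 2
      abs_le := ?_, grad_le := ?_, lipschitz := ?_, lipschitz_sq := ?_ }⟩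
  · filter_upwards [hB₁b] with v hv θ hθ using Real.abs_le_sqrt (hv θ hθ)
  · filter_upwards [hB₂b] with v hv θ hθ i
    exact Real.abs_le_sqrt ((Finset.single_le_sum (f := fun i => paramGrad g v.1 θ i ^ 2)
      (fun i _ => sq_nonneg _) (Finset.mem_univ i)).trans (hv θ hθ))
  · filter_upwards [hB₂b] with v hv θ hθ θ' hθ'
    exact h.convex.norm_image_sub_le_of_norm_fderiv_le (𝕜 := ℝ)
      (fun θ hθ => h.differentiableAt v.1 hθ)
      (fun θ hθ => (norm_fderiv_le_sqrt_sum_paramGrad v.1 θ).trans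
        (Real.sqrt_le_sqrt (hv θ hθ))) hθ' hθ
  · filter_upwards [hB₃b] with v hv θ hθ θ' hθ'
    have hd : ∀ θ ∈ Θ, HasFDerivAt (fun θ => (v.2 - g v.1 θ) ^ 2)
        ((2 * (v.2 - g v.1 θ)) • -fderiv ℝ (g v.1) θ) θ := by
      intro θ hθ
      have := ((h.differentiableAt v.1 hθ).hasFDerivAt.const_sub v.2).pow 2
      simpa using this
    refine h.convex.norm_image_sub_le_of_norm_fderiv_le (𝕜 := ℝ)
      (f := fun θ => (v.2 - g v.1 θ) ^ 2)
      (fun θ hθ => (hd θ hθ).differentiableAt) (fun θ hθ => ?_) hθ' hθ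
    rw [(hd θ hθ).fderiv, norm_smul, norm_neg, norm_mul, mul_assoc]
    have h1 : ‖(2 : ℝ)‖ = 2 := by norm_num
    rw [h1]
    refine mul_le_mul_of_nonneg_left ?_ zero_le_two
    refine le_trans (mul_le_mul_of_nonneg_left (norm_fderiv_le_sqrt_sum_paramGrad v.1 θ)
      (norm_nonneg _)) ?_
    rw [Real.norm_eq_abs, ← Real.sqrt_sq_eq_abs, ← Real.sqrt_mul (sq_nonneg _)]
    exact Real.sqrt_le_sqrt (hv θ hθ)

/-! ### Quadratic growth of the population criterion -/

theorem risk_eq (h : RegularityConditions μ X Y g Θ θs) (θ : EuclideanSpace ℝ (Fin d)) :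
    risk μ X Y g θ = ∫ v, (v.2 - g v.1 θ) ^ 2 ∂(μ.map fun ω => (X ω, Y ω)) := by
  have hm : Measurable fun v : EuclideanSpace ℝ (Fin p) × ℝ => (v.2 - g v.1 θ) ^ 2 :=
    (measurable_snd.sub ((h.measurable_g θ).comp measurable_fst)).pow_const 2
  rw [integral_map h.measurable_pair.aemeasurable hm.aestronglyMeasurable]
  rfl

theorem memLp_g [IsProbabilityMeasure μ] (h : RegularityConditions μ X Y g Θ θs)
    {θ : EuclideanSpace ℝ (Fin d)} (hθ : θ ∈ Θ) : MemLp (fun ω => g (X ω) θ) 2 μ := by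
  obtain ⟨Q, G, L, hE⟩ := h.exists_isEnvelope
  have hQ : MemLp (Q ∘ fun ω => (X ω, Y ω)) 2 μ :=
    (memLp_map_measure_iff hE.memLp_Q.1 h.measurable_pair.aemeasurable).1 hE.memLp_Q
  refine hQ.mono ((h.measurable_g θ).comp h.measurable_X).aestronglyMeasurable ?_
  filter_upwards [ae_of_ae_map h.measurable_pair.aemeasurable hE.abs_le] with ω hω
  rw [Real.norm_eq_abs]
  exact (hω θ hθ).trans (le_abs_self _)

theorem memLp_Y (h : RegularityConditions μ X Y g Θ θs) : MemLp Y 2 μ :=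
  (memLp_two_iff_integrable_sq h.measurable_Y.aestronglyMeasurable).2 h.integrable_Y_sq

theorem integrable_sq_residual [IsProbabilityMeasure μ] (h : RegularityConditions μ X Y g Θ θs)
    {θ : EuclideanSpace ℝ (Fin d)} (hθ : θ ∈ Θ) :
    Integrable (fun v : EuclideanSpace ℝ (Fin p) × ℝ => (v.2 - g v.1 θ) ^ 2)
      (μ.map fun ω => (X ω, Y ω)) := by
  have hm : Measurable fun v : EuclideanSpace ℝ (Fin p) × ℝ => (v.2 - g v.1 θ) ^ 2 :=
    (measurable_snd.sub ((h.measurable_g θ).comp measurable_fst)).pow_const 2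
  rw [integrable_map_measure hm.aestronglyMeasurable h.measurable_pair.aemeasurable]
  exact (h.memLp_Y.sub (h.memLp_g hθ)).integrable_sq

/-- By compactness, quadratic growth of the criterion near its unique minimizer extends to all of
the parameter space. -/
theorem exists_global_growth [IsProbabilityMeasure μ] (h : RegularityConditions μ X Y g Θ θs)
    (hloc : ∃ c > 0, ∃ r > 0, ∀ θ ∈ Θ, ‖θ - θs‖ < r →
      risk μ X Y g θs + c * ‖θ - θs‖ ^ 2 ≤ risk μ X Y g θ) :
    ∃ c > 0, ∀ θ ∈ Θ, risk μ X Y g θs + c * ‖θ - θs‖ ^ 2 ≤ risk μ X Y g θ := by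
  obtain ⟨c, hc, r, hr, hcr⟩ := hloc
  obtain ⟨Q, G, L, hE⟩ := h.exists_isEnvelope
  have : IsProbabilityMeasure (μ.map fun ω => (X ω, Y ω)) :=
    Measure.isProbabilityMeasure_map h.measurable_pair.aemeasurable
  have hcont : ContinuousOn (risk μ X Y g) Θ := by
    refine continuousOn_of_abs_sub_le
      (K := ∫ v, L v ∂(μ.map fun ω => (X ω, Y ω))) fun θ hθ θ' hθ' => ?_
    rw [h.risk_eq, h.risk_eq, ← integral_sub (h.integrable_sq_residual hθ)
      (h.integrable_sq_residual hθ'), ← integral_mul_const, ← Real.norm_eq_abs]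
    refine norm_integral_le_of_norm_le ((hE.memLp_L.integrable one_le_two).mul_const _) ?_
    filter_upwards [hE.lipschitz_sq] with v hv
    exact hv θ hθ θ' hθ'
  set K : Set (EuclideanSpace ℝ (Fin d)) := Θ \ Metric.ball θs r with hKdef
  have hK : IsCompact K := h.isCompact.diff Metric.isOpen_ball
  rcases K.eq_empty_or_nonempty with hKe | hKn
  · refine ⟨c, hc, fun θ hθ => hcr θ hθ ?_⟩
    by_contra hcon
    have : θ ∈ K := ⟨hθ, by rwa [mem_ball_iff_norm]⟩
    rw [hKe] at this
    exact this
  obtain ⟨θ₁, hθ₁, hmin⟩ := hK.exists_isMinOn hKn (hcont.mono Set.sdiff_subset)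
  have hne : θ₁ ≠ θs := by
    rintro rfl
    exact hθ₁.2 (Metric.mem_ball_self hr)
  have hm : 0 < risk μ X Y g θ₁ - risk μ X Y g θs := sub_pos.2 (h.unique_min θ₁ hθ₁.1 hne)
  obtain ⟨R, hR⟩ := h.isCompact.isBounded.subset_ball θs
  have hRpos : 0 < R := by
    have := hR h.mem
    exact Metric.pos_of_mem_ball this
  refine ⟨min c ((risk μ X Y g θ₁ - risk μ X Y g θs) / R ^ 2), lt_min hc (by positivity),
    fun θ hθ => ?_⟩
  by_cases hlt : ‖θ - θs‖ < r
  · refine le_trans ?_ (hcr θ hθ hlt)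
    gcongr
    exact min_le_left _ _
  · have h1 : risk μ X Y g θ₁ ≤ risk μ X Y g θ := hmin ⟨hθ, by rwa [mem_ball_iff_norm]⟩
    have h2 : ‖θ - θs‖ < R := mem_ball_iff_norm.1 (hR hθ)
    have h3 : min c ((risk μ X Y g θ₁ - risk μ X Y g θs) / R ^ 2) * ‖θ - θs‖ ^ 2 ≤
        (risk μ X Y g θ₁ - risk μ X Y g θs) / R ^ 2 * R ^ 2 := by
      gcongr
      exact min_le_right _ _
    rw [div_mul_cancel₀ _ (by positivity)] at h3
    linarith

/-- Under the null hypothesis the criterion splits into the error variance and the squared distance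
of the regression functions. -/
theorem risk_eq_of_null [IsProbabilityMeasure μ] (h : RegularityConditions μ X Y g Θ θs)
    {ε : Ω → ℝ} (hind : IndepFun X ε μ) (hε0 : ∫ ω, ε ω ∂μ = 0)
    {θ₀ : EuclideanSpace ℝ (Fin d)} (hθ₀ : θ₀ ∈ Θ) (hY : ∀ᵐ ω ∂μ, Y ω = g (X ω) θ₀ + ε ω)
    {θ : EuclideanSpace ℝ (Fin d)} (hθ : θ ∈ Θ) :
    risk μ X Y g θ = ∫ ω, ε ω ^ 2 ∂μ + ∫ ω, (g (X ω) θ - g (X ω) θ₀) ^ 2 ∂μ := by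
  have hεL : MemLp ε 2 μ := by
    refine (memLp_congr_ae ?_).1 (h.memLp_Y.sub (h.memLp_g hθ₀))
    filter_upwards [hY] with ω hω
    simp [hω]
  have hD : MemLp (fun ω => g (X ω) θ - g (X ω) θ₀) 2 μ := (h.memLp_g hθ).sub (h.memLp_g hθ₀)
  have hcross : ∫ ω, (g (X ω) θ - g (X ω) θ₀) * ε ω ∂μ = 0 := by
    have hi : IndepFun (fun ω => g (X ω) θ - g (X ω) θ₀) ε μ :=
      hind.comp (φ := fun x => g x θ - g x θ₀) (ψ := id)
        ((h.measurable_g θ).sub (h.measurable_g θ₀)) measurable_id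
    rw [hi.integral_fun_mul_eq_mul_integral hD.1 hεL.1, hε0, mul_zero]
  have hci : Integrable (fun ω => (g (X ω) θ - g (X ω) θ₀) * ε ω) μ := hD.integrable_mul hεL
  calc risk μ X Y g θ = ∫ ω, ((ε ω ^ 2 + (g (X ω) θ - g (X ω) θ₀) ^ 2) -
        2 * ((g (X ω) θ - g (X ω) θ₀) * ε ω)) ∂μ := by
        refine integral_congr_ae ?_
        filter_upwards [hY] with ω hω
        rw [hω]
        ring
    _ = _ := by
        have hsum : Integrable (fun ω => ε ω ^ 2 + (g (X ω) θ - g (X ω) θ₀) ^ 2) μ :=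
          hεL.integrable_sq.add hD.integrable_sq
        rw [integral_sub hsum (hci.const_mul 2),
          integral_add hεL.integrable_sq hD.integrable_sq, integral_const_mul, hcross]
        ring

/-- The true parameter of the null hypothesis is the least squares parameter. -/
theorem eq_of_null [IsProbabilityMeasure μ] (h : RegularityConditions μ X Y g Θ θs)
    {ε : Ω → ℝ} (hind : IndepFun X ε μ) (hε0 : ∫ ω, ε ω ∂μ = 0)
    {θ₀ : EuclideanSpace ℝ (Fin d)} (hθ₀ : θ₀ ∈ Θ) (hY : ∀ᵐ ω ∂μ, Y ω = g (X ω) θ₀ + ε ω) :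
    θ₀ = θs := by
  by_contra hne
  have h1 := h.unique_min θ₀ hθ₀ hne
  rw [h.risk_eq_of_null hind hε0 hθ₀ hY hθ₀, h.risk_eq_of_null hind hε0 hθ₀ hY h.mem] at h1
  have h2 : 0 ≤ ∫ ω, (g (X ω) θs - g (X ω) θ₀) ^ 2 ∂μ := integral_nonneg fun ω => sq_nonneg _
  simp only [sub_self] at h1
  norm_num at h1
  linarith

/-- Nonsingularity of `E[ġ ġᵀ]` makes the mean squared distance of the regression functions grow
quadratically: along a sequence of parameters violating this, a subsequence of the normalized
increments converges to a unit vector `u` with `E(ġᵀu)² = 0`. -/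
theorem exists_local_growth_sq_dist [IsProbabilityMeasure μ]
    (h : RegularityConditions μ X Y g Θ θs) :
    ∃ c > 0, ∃ r > 0, ∀ θ ∈ Θ, ‖θ - θs‖ < r →
      c * ‖θ - θs‖ ^ 2 ≤ ∫ ω, (g (X ω) θ - g (X ω) θs) ^ 2 ∂μ := by
  obtain ⟨Q, G, L, hE⟩ := h.exists_isEnvelope
  have hpair := h.measurable_pair.aemeasurable (μ := μ)
  have hG : MemLp (fun ω => G (X ω, Y ω)) 2 μ :=
    (memLp_map_measure_iff hE.memLp_G.1 hpair).1 hE.memLp_G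
  by_contra! hcon
  choose θ hθΘ hθr hθ using fun k : ℕ =>
    hcon (1 / ((k : ℝ) + 1)) (by positivity) (1 / ((k : ℝ) + 1)) (by positivity)
  have hne : ∀ k, 0 < ‖θ k - θs‖ := by
    intro k
    refine (norm_nonneg _).lt_of_ne fun h0 => ?_
    have := hθ k
    rw [← h0] at this
    have h2 : 0 ≤ ∫ ω, (g (X ω) (θ k) - g (X ω) θs) ^ 2 ∂μ := integral_nonneg fun ω => sq_nonneg _
    norm_num at this
    linarith
  let u : ℕ → EuclideanSpace ℝ (Fin d) := fun k => ‖θ k - θs‖⁻¹ • (θ k - θs)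
  have hu : ∀ k, u k ∈ Metric.sphere (0 : EuclideanSpace ℝ (Fin d)) 1 := by
    intro k
    rw [mem_sphere_zero_iff_norm, norm_smul, norm_inv, norm_norm, inv_mul_cancel₀ (hne k).ne']
  obtain ⟨u₀, hu₀, φ, hφ, hlim⟩ := (isCompact_sphere _ _).tendsto_subseq hu
  have hone : Filter.Tendsto (fun k => 1 / ((φ k : ℝ) + 1)) Filter.atTop (nhds 0) :=
    tendsto_one_div_add_atTop_nhds_zero_nat.comp hφ.tendsto_atTop
  have hθlim : Filter.Tendsto (fun k => θ (φ k) - θs) Filter.atTop (nhds 0) :=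
    squeeze_zero_norm (fun k => (hθr (φ k)).le) hone
  have hptw : ∀ ω, Filter.Tendsto (fun k =>
      (‖θ (φ k) - θs‖⁻¹ * (g (X ω) (θ (φ k)) - g (X ω) θs)) ^ 2) Filter.atTop
      (nhds ((fderiv ℝ (g (X ω)) θs u₀) ^ 2)) := by
    intro ω
    have h1 := ((h.differentiableAt (X ω) h.mem).hasFDerivAt.hasFDerivWithinAt (s := Set.univ)).lim
      (c := fun k => ‖θ (φ k) - θs‖⁻¹) hθlim (by simp) hlim
    simpa using h1.pow 2
  have hDm : ∀ θ, Measurable fun ω => g (X ω) θ - g (X ω) θs := fun θ =>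
    ((h.measurable_g θ).comp h.measurable_X).sub ((h.measurable_g θs).comp h.measurable_X)
  have hdct : Filter.Tendsto (fun k =>
      ∫ ω, (‖θ (φ k) - θs‖⁻¹ * (g (X ω) (θ (φ k)) - g (X ω) θs)) ^ 2 ∂μ) Filter.atTop
      (nhds (∫ ω, (fderiv ℝ (g (X ω)) θs u₀) ^ 2 ∂μ)) := by
    refine tendsto_integral_of_dominated_convergence (fun ω => G (X ω, Y ω) ^ 2)
      (fun k => (((hDm _).const_mul _).pow_const 2).aestronglyMeasurable) hG.integrable_sq
      (fun k => ?_) (ae_of_all _ hptw)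
    filter_upwards [ae_of_ae_map hpair hE.lipschitz] with ω hω
    have h1 := hω (θ (φ k)) (hθΘ _) θs h.mem
    rw [norm_pow, norm_mul, norm_inv, norm_norm, Real.norm_eq_abs]
    refine pow_le_pow_left₀ (by positivity) ?_ 2
    rw [inv_mul_le_iff₀ (hne _)]
    linarith
  have hzero : ∫ ω, (fderiv ℝ (g (X ω)) θs u₀) ^ 2 ∂μ ≤ 0 := by
    refine le_of_tendsto_of_tendsto' hdct hone fun k => ?_
    simp_rw [mul_pow]
    rw [integral_const_mul, inv_pow, inv_mul_le_iff₀ (pow_pos (hne _) 2), mul_comm]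
    exact (hθ (φ k)).le
  have hgm : ∀ i, Measurable fun ω => paramGrad g (X ω) θs i := fun i =>
    (measurable_paramGrad h.measurable_g (fun x => h.differentiableAt x h.mem) i).comp
      h.measurable_X
  have hgL : ∀ i, MemLp (fun ω => paramGrad g (X ω) θs i) 2 μ := by
    intro i
    refine hG.mono (hgm i).aestronglyMeasurable ?_
    filter_upwards [ae_of_ae_map hpair hE.grad_le] with ω hω
    exact (hω θs h.mem i).trans (le_abs_self _)
  have hdL : MemLp (fun ω => fderiv ℝ (g (X ω)) θs u₀) 2 μ := by
    simp_rw [fderiv_apply_eq_sum_paramGrad]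
    exact memLp_finsetSum _ fun i _ => (hgL i).mul_const (u₀ i)
  have hae : ∀ᵐ ω ∂μ, fderiv ℝ (g (X ω)) θs u₀ = 0 := by
    have h1 := (integral_eq_zero_iff_of_nonneg (fun ω => sq_nonneg (fderiv ℝ (g (X ω)) θs u₀))
      hdL.integrable_sq).1 (le_antisymm hzero (integral_nonneg fun ω => sq_nonneg _))
    filter_upwards [h1] with ω hω
    simpa using hω
  refine h.nonsingular (Matrix.exists_mulVec_eq_zero_iff.1 ⟨u₀.ofLp, ?_, ?_⟩)
  · intro h0
    have h1 : u₀ = 0 := by ext i; exact congrFun h0 i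
    rw [h1] at hu₀
    simp at hu₀
  · ext i
    have h1 : ∀ j, Integrable (fun ω => paramGrad g (X ω) θs i * paramGrad g (X ω) θs j) μ :=
      fun j => (hgL i).integrable_mul (hgL j)
    simp only [Matrix.mulVec, dotProduct, gradGram, Matrix.of_apply, Pi.zero_apply]
    simp_rw [← integral_mul_const]
    rw [← integral_finsetSum _ fun j _ => (h1 j).mul_const _]
    refine integral_eq_zero_of_ae ?_
    filter_upwards [hae] with ω hω
    simp_rw [mul_assoc]
    rw [← Finset.mul_sum, ← fderiv_apply_eq_sum_paramGrad, hω, mul_zero]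
    rfl

theorem exists_local_growth_of_null [IsProbabilityMeasure μ]
    (h : RegularityConditions μ X Y g Θ θs) {ε : Ω → ℝ}
    (hind : IndepFun X ε μ) (hε0 : ∫ ω, ε ω ∂μ = 0) (hY : ∀ᵐ ω ∂μ, Y ω = g (X ω) θs + ε ω) :
    ∃ c > 0, ∃ r > 0, ∀ θ ∈ Θ, ‖θ - θs‖ < r →
      risk μ X Y g θs + c * ‖θ - θs‖ ^ 2 ≤ risk μ X Y g θ := by
  obtain ⟨c, hc, r, hr, hcr⟩ := h.exists_local_growth_sq_dist
  refine ⟨c, hc, r, hr, fun θ hθ hlt => ?_⟩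
  rw [h.risk_eq_of_null hind hε0 h.mem hY hθ, h.risk_eq_of_null hind hε0 h.mem hY h.mem]
  have := hcr θ hθ hlt
  simp only [sub_self]
  norm_num
  linarith

end RegularityConditions

/-! ### Second moments of degenerate sums -/

theorem memLp_two_comp_sample {W S : Type*} [MeasurableSpace W] [MeasurableSpace S] {ν : Measure W}
    {P : Measure S} {w : ℕ → S → W} {D : W → ℝ} (hw : ∀ j, Measurable (w j))
    (hlaw : ∀ j, P.map (w j) = ν) (hD : MemLp D 2 ν) (j : ℕ) : MemLp (fun s => D (w j s)) 2 P := by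
  rw [← hlaw j] at hD
  exact (memLp_map_measure_iff hD.1 (hw j).aemeasurable).1 hD

section Degenerate

variable {W S : Type*} [MeasurableSpace W] [MeasurableSpace S] {ν : Measure W}
  {P : Measure S} {w : ℕ → S → W} {f : W → W → ℂ} {D : W → ℝ}

theorem integrable_inner_kernel (hw : ∀ j, Measurable (w j)) (hlaw : ∀ j, P.map (w j) = ν)
    (hf : Measurable (Function.uncurry f)) (hD : MemLp D 2 ν) (hfD : ∀ v v', ‖f v v'‖ ≤ D v')
    (j l l' : ℕ) :
    Integrable (fun s => inner ℝ (f (w j s) (w l s)) (f (w j s) (w l' s))) P := by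
  have hm : ∀ l, Measurable fun s => f (w j s) (w l s) := fun l =>
    hf.comp ((hw j).prodMk (hw l))
  refine Integrable.mono' ((memLp_two_comp_sample hw hlaw hD l).integrable_mul
    (memLp_two_comp_sample hw hlaw hD l')) ((hm l).inner (hm l')).aestronglyMeasurable
    (ae_of_all _ fun s => ?_)
  refine (norm_inner_le_norm _ _).trans ?_
  exact mul_le_mul (hfD _ _) (hfD _ _) (norm_nonneg _) ((norm_nonneg _).trans (hfD (w j s) _))

theorem integral_norm_sq_kernel_le (hw : ∀ j, Measurable (w j)) (hlaw : ∀ j, P.map (w j) = ν)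
    (hD : MemLp D 2 ν) (hfD : ∀ v v', ‖f v v'‖ ≤ D v')
    (j l : ℕ) :
    ∫ s, ‖f (w j s) (w l s)‖ ^ 2 ∂P ≤ ∫ v, D v ^ 2 ∂ν := by
  have h1 : ∫ v, D v ^ 2 ∂ν = ∫ s, D (w l s) ^ 2 ∂P := by
    rw [← hlaw l, integral_map (hw l).aemeasurable]
    rw [hlaw l]
    exact hD.integrable_sq.aestronglyMeasurable
  rw [h1]
  refine integral_mono_of_nonneg (ae_of_all _ fun s => sq_nonneg _)
    (memLp_two_comp_sample hw hlaw hD l).integrable_sq (ae_of_all _ fun s => ?_)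
  exact pow_le_pow_left₀ (norm_nonneg _) (hfD _ _) 2

theorem memLp_two_sum_kernel (hw : ∀ j, Measurable (w j)) (hlaw : ∀ j, P.map (w j) = ν)
    (hf : Measurable (Function.uncurry f)) (hD : MemLp D 2 ν) (hfD : ∀ v v', ‖f v v'‖ ≤ D v')
    (J : Finset ℕ) (j : ℕ) : MemLp (fun s => ∑ l ∈ J, f (w j s) (w l s)) 2 P := by
  refine memLp_finsetSum _ fun l _ => ?_
  refine (memLp_two_comp_sample hw hlaw hD l).mono
    (hf.comp ((hw j).prodMk (hw l))).aestronglyMeasurable (ae_of_all _ fun s => ?_)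
  exact (hfD _ _).trans (le_abs_self _)

variable [IsProbabilityMeasure ν] [IsProbabilityMeasure P]

/-- For a kernel whose second argument integrates to zero, distinct summands `f (w j) (w l)` are
orthogonal: integrate over `w l'` first. -/
theorem integral_inner_kernel_eq_zero (hw : ∀ j, Measurable (w j)) (hlaw : ∀ j, P.map (w j) = ν)
    (hiid : iIndepFun w P) (hf : Measurable (Function.uncurry f)) (hD : MemLp D 2 ν)
    (hfD : ∀ v v', ‖f v v'‖ ≤ D v') (hf0 : ∀ v, ∫ v', f v v' ∂ν = 0) {j l l' : ℕ}
    (hj : j ≠ l') (hl : l ≠ l') :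
    ∫ s, inner ℝ (f (w j s) (w l s)) (f (w j s) (w l' s)) ∂P = 0 := by
  have hmap := ((hiid.indepFun_prodMk hw j l l' hj hl).map_prod_eq_prod_map_map
    ((hw j).prodMk (hw l)).aemeasurable (hw l').aemeasurable)
  rw [hlaw l'] at hmap
  let F : (W × W) × W → ℝ := fun z => inner ℝ (f z.1.1 z.1.2) (f z.1.1 z.2)
  have hF : Measurable F := by
    have h1 : Measurable fun z : (W × W) × W => f z.1.1 z.1.2 := hf.comp measurable_fst
    have h2 : Measurable fun z : (W × W) × W => f z.1.1 z.2 :=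
      hf.comp ((measurable_fst.comp measurable_fst).prodMk measurable_snd)
    exact h1.inner h2
  have htriple : Measurable fun s => ((w j s, w l s), w l' s) :=
    ((hw j).prodMk (hw l)).prodMk (hw l')
  have hFi : Integrable F (P.map fun s => ((w j s, w l s), w l' s)) :=
    (integrable_map_measure hF.aestronglyMeasurable htriple.aemeasurable).2
      (integrable_inner_kernel hw hlaw hf hD hfD j l l')
  have h1 : ∫ s, inner ℝ (f (w j s) (w l s)) (f (w j s) (w l' s)) ∂P =
      ∫ z, F z ∂(P.map fun s => ((w j s, w l s), w l' s)) :=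
    (integral_map htriple.aemeasurable hF.aestronglyMeasurable).symm
  rw [hmap] at hFi
  have hfi : ∀ v, Integrable (f v) ν := fun v =>
    Integrable.mono' (hD.integrable one_le_two) (hf.of_uncurry_left).aestronglyMeasurable
      (ae_of_all _ fun v' => hfD v v')
  rw [h1, hmap, integral_prod _ hFi]
  simp only [F]
  have h2 : ∀ z : W × W, ∫ v', inner ℝ (f z.1 z.2) (f z.1 v') ∂ν = 0 := fun z => by
    rw [integral_inner (hfi z.1), hf0, inner_zero_right]
  exact integral_eq_zero_of_ae (ae_of_all _ h2)

/-- By orthogonality the mean square of the sum is the sum of the mean squares. -/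
theorem integral_norm_sq_sum_kernel_le (hw : ∀ j, Measurable (w j))
    (hlaw : ∀ j, P.map (w j) = ν) (hiid : iIndepFun w P) (hf : Measurable (Function.uncurry f))
    (hD : MemLp D 2 ν) (hfD : ∀ v v', ‖f v v'‖ ≤ D v') (hf0 : ∀ v, ∫ v', f v v' ∂ν = 0)
    {J : Finset ℕ} {j : ℕ} (hj : j ∉ J) :
    ∫ s, ‖∑ l ∈ J, f (w j s) (w l s)‖ ^ 2 ∂P ≤ J.card * ∫ v, D v ^ 2 ∂ν := by
  have h1 : ∀ s, ‖∑ l ∈ J, f (w j s) (w l s)‖ ^ 2 =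
      ∑ l ∈ J, ∑ l' ∈ J, inner ℝ (f (w j s) (w l s)) (f (w j s) (w l' s)) := by
    intro s
    rw [← real_inner_self_eq_norm_sq, sum_inner]
    simp_rw [inner_sum]
  simp_rw [h1]
  rw [integral_finsetSum _ fun l _ => integrable_finsetSum _ fun l' _ =>
    integrable_inner_kernel hw hlaw hf hD hfD j l l']
  rw [← nsmul_eq_mul]
  refine Finset.sum_le_card_nsmul _ _ _ fun l hl => ?_
  rw [integral_finsetSum _ fun l' _ => integrable_inner_kernel hw hlaw hf hD hfD j l l',
    Finset.sum_eq_single_of_mem l hl fun l' hl' hne => integral_inner_kernel_eq_zero hw hlaw hiid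
      hf hD hfD hf0 (by rintro rfl; exact hj hl') hne.symm]
  simp_rw [real_inner_self_eq_norm_sq]
  exact integral_norm_sq_kernel_le hw hlaw hD hfD j l

/-- The mean square of the average of `f (w j) (w l)` over `l < n` is of the order of `1 / n`, also
when `j < n`: the diagonal term is negligible. -/
theorem integral_norm_sq_average_kernel_le (hw : ∀ j, Measurable (w j))
    (hlaw : ∀ j, P.map (w j) = ν) (hiid : iIndepFun w P) (hf : Measurable (Function.uncurry f))
    (hD : MemLp D 2 ν) (hfD : ∀ v v', ‖f v v'‖ ≤ D v') (hf0 : ∀ v, ∫ v', f v v' ∂ν = 0)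
    {n : ℕ} (hn : 1 ≤ n) (j : ℕ) :
    ∫ s, ‖(n : ℂ)⁻¹ * ∑ l ∈ Finset.range n, f (w j s) (w l s)‖ ^ 2 ∂P ≤
      2 * (∫ v, D v ^ 2 ∂ν) * (n : ℝ)⁻¹ := by
  set J := (Finset.range n).erase j with hJ
  have hn' : (0 : ℝ) < n := by exact_mod_cast hn
  have hD0 : 0 ≤ ∫ v, D v ^ 2 ∂ν := integral_nonneg fun v => sq_nonneg _
  have hsplit : ∀ s, ‖(n : ℂ)⁻¹ * ∑ l ∈ Finset.range n, f (w j s) (w l s)‖ ^ 2 ≤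
      ((n : ℝ)⁻¹) ^ 2 * (2 * (if j ∈ Finset.range n then ‖f (w j s) (w j s)‖ ^ 2 else 0) +
        2 * ‖∑ l ∈ J, f (w j s) (w l s)‖ ^ 2) := by
    intro s
    rw [norm_mul, mul_pow, norm_inv, Complex.norm_natCast]
    refine mul_le_mul_of_nonneg_left ?_ (by positivity)
    split_ifs with hmem
    · rw [← Finset.add_sum_erase _ _ hmem]
      have h1 := norm_add_le (f (w j s) (w j s)) (∑ l ∈ J, f (w j s) (w l s))
      have h2 := pow_le_pow_left₀ (norm_nonneg _) h1 2
      nlinarith [sq_nonneg (‖f (w j s) (w j s)‖ - ‖∑ l ∈ J, f (w j s) (w l s)‖)]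
    · rw [hJ, Finset.erase_eq_of_notMem hmem]
      nlinarith [sq_nonneg ‖∑ l ∈ Finset.range n, f (w j s) (w l s)‖]
  have hi1 : Integrable (fun s => if j ∈ Finset.range n then ‖f (w j s) (w j s)‖ ^ 2 else 0) P := by
    split_ifs
    · simpa using (memLp_two_sum_kernel hw hlaw hf hD hfD {j} j).norm.integrable_sq
    · exact integrable_zero _ _ _
  have hi2 : Integrable (fun s => ‖∑ l ∈ J, f (w j s) (w l s)‖ ^ 2) P :=
    (memLp_two_sum_kernel hw hlaw hf hD hfD J j).norm.integrable_sq
  have h2 := integral_norm_sq_sum_kernel_le hw hlaw hiid hf hD hfD hf0 (Finset.notMem_erase j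
    (Finset.range n))
  have hb : ∫ s, (if j ∈ Finset.range n then ‖f (w j s) (w j s)‖ ^ 2 else 0) ∂P +
      ∫ s, ‖∑ l ∈ J, f (w j s) (w l s)‖ ^ 2 ∂P ≤ n * ∫ v, D v ^ 2 ∂ν := by
    by_cases hmem : j ∈ Finset.range n
    · simp only [hmem, if_true]
      have h1 := integral_norm_sq_kernel_le hw hlaw hD hfD j j
      rw [Finset.card_erase_of_mem hmem, Finset.card_range, Nat.cast_sub hn] at h2
      push_cast at h2
      linarith
    · simp only [hmem, if_false, integral_zero, zero_add]
      rw [hJ]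
      rw [Finset.erase_eq_of_notMem hmem, Finset.card_range] at h2
      rwa [Finset.erase_eq_of_notMem hmem]
  calc _ ≤ ∫ s, ((n : ℝ)⁻¹) ^ 2 *
        (2 * (if j ∈ Finset.range n then ‖f (w j s) (w j s)‖ ^ 2 else 0) +
          2 * ‖∑ l ∈ J, f (w j s) (w l s)‖ ^ 2) ∂P :=
        integral_mono_of_nonneg (ae_of_all _ fun s => sq_nonneg _)
          (((hi1.const_mul 2).add (hi2.const_mul 2)).const_mul _) (ae_of_all _ hsplit)
    _ = ((n : ℝ)⁻¹) ^ 2 *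
        (2 * (∫ s, (if j ∈ Finset.range n then ‖f (w j s) (w j s)‖ ^ 2 else 0) ∂P +
          ∫ s, ‖∑ l ∈ J, f (w j s) (w l s)‖ ^ 2 ∂P)) := by
        rw [integral_const_mul, integral_add (hi1.const_mul 2) (hi2.const_mul 2),
          integral_const_mul, integral_const_mul]
        ring
    _ ≤ ((n : ℝ)⁻¹) ^ 2 * (2 * (n * ∫ v, D v ^ 2 ∂ν)) := by gcongr
    _ = _ := by field_simp

theorem measurable_average_kernel (hw : ∀ j, Measurable (w j))
    (hf : Measurable (Function.uncurry f)) (n j : ℕ) :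
    Measurable fun s => (n : ℂ)⁻¹ * ∑ l ∈ Finset.range n, f (w j s) (w l s) :=
  (Finset.measurable_sum _ fun l _ => hf.comp ((hw j).prodMk (hw l))).const_mul _

theorem lintegral_norm_sq_average_kernel_le (hw : ∀ j, Measurable (w j))
    (hlaw : ∀ j, P.map (w j) = ν) (hiid : iIndepFun w P) (hf : Measurable (Function.uncurry f))
    (hD : MemLp D 2 ν) (hfD : ∀ v v', ‖f v v'‖ ≤ D v') (hf0 : ∀ v, ∫ v', f v v' ∂ν = 0)
    {n : ℕ} (hn : 1 ≤ n) (j : ℕ) :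
    ∫⁻ s, ‖‖(n : ℂ)⁻¹ * ∑ l ∈ Finset.range n, f (w j s) (w l s)‖ ^ 2‖ₑ ∂P ≤
      ENNReal.ofReal (2 * (∫ v, D v ^ 2 ∂ν) * (n : ℝ)⁻¹) := by
  have hi : Integrable (fun s => ‖(n : ℂ)⁻¹ * ∑ l ∈ Finset.range n, f (w j s) (w l s)‖ ^ 2) P :=
    ((memLp_two_sum_kernel hw hlaw hf hD hfD _ j).const_mul _).norm.integrable_sq
  rw [← ofReal_integral_norm_eq_lintegral_enorm hi]
  refine ENNReal.ofReal_le_ofReal ?_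
  simp_rw [norm_pow, norm_norm]
  exact integral_norm_sq_average_kernel_le hw hlaw hiid hf hD hfD hf0 hn j

/-- Averages of a square integrable complex function converge to its mean at the rate
`n ^ (-1/2)`. -/
theorem isBigOInProbability_average_sub_integral (hw : ∀ j, Measurable (w j))
    (hlaw : ∀ j, P.map (w j) = ν) (hiid : iIndepFun w P) {F : W → ℂ} (hF : Measurable F)
    (hFL : MemLp F 2 ν) :
    IsBigOInProbability P
      (fun n s => ‖(n : ℂ)⁻¹ * ∑ j ∈ Finset.range n, F (w j s) - ∫ v, F v ∂ν‖)
      (fun n => √((n : ℝ)⁻¹)) := by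
  have hf : Measurable (Function.uncurry fun _ v' : W => F v' - ∫ v, F v ∂ν) :=
    (hF.comp measurable_snd).sub measurable_const
  have hD : MemLp (fun v' => ‖F v' - ∫ v, F v ∂ν‖) 2 ν := (hFL.sub (memLp_const _)).norm
  have hFi : Integrable F ν := hFL.integrable one_le_two
  have h1 : IsBigOInProbability P
      (fun n s => ‖(n : ℂ)⁻¹ * ∑ l ∈ Finset.range n, (F (w l s) - ∫ v, F v ∂ν)‖ ^ 2)
      (fun n => (n : ℝ)⁻¹) := by
    refine IsBigOInProbability.of_lintegral_le
      (K := 2 * ∫ v', ‖F v' - ∫ v, F v ∂ν‖ ^ 2 ∂ν)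
      (fun n => ((measurable_average_kernel hw hf n n).norm.pow_const 2).aemeasurable)
      (fun n hn => by have : (0 : ℝ) < n := by exact_mod_cast hn
                      positivity) fun n hn => ?_
    refine lintegral_norm_sq_average_kernel_le hw hlaw hiid hf hD (fun v v' => le_rfl)
      (fun v => ?_) hn n
    rw [integral_sub hFi (integrable_const _)]
    simp
  refine h1.sqrt.mono fun n hn => ae_of_all _ fun s => le_of_eq ?_
  have hn' : (n : ℂ) ≠ 0 := by exact_mod_cast (by omega : n ≠ 0)
  rw [Real.sqrt_sq (norm_nonneg _), Finset.sum_sub_distrib]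
  congr 2
  simp only [Finset.sum_const, Finset.card_range, nsmul_eq_mul]
  field_simp

end Degenerate

/-! ### Empirical characteristic moments -/

theorem norm_exp_I_mul_sub_le (a b : ℝ) :
    ‖Complex.exp (Complex.I * a) - Complex.exp (Complex.I * b)‖ ≤ |a - b| := by
  have h1 : Complex.exp (Complex.I * a) - Complex.exp (Complex.I * b) =
      Complex.exp (Complex.I * b) * (Complex.exp (Complex.I * ((a - b : ℝ) : ℂ)) - 1) := by
    rw [mul_sub, ← Complex.exp_add]
    push_cast
    ring_nf
  rw [h1, norm_mul, Complex.norm_exp_I_mul_ofReal, one_mul]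
  exact Real.norm_exp_I_mul_ofReal_sub_one_le

theorem norm_exp_I_mul_mul (t e : ℝ) : ‖Complex.exp (Complex.I * t * e)‖ = 1 := by
  rw [mul_assoc, ← Complex.ofReal_mul, Complex.norm_exp_I_mul_ofReal]

section CharMoment

variable {p : ℕ}

theorem norm_charMomentEst_le (n : ℕ) (x : ℕ → EuclideanSpace ℝ (Fin p)) (e : ℕ → ℝ) (t : ℝ)
    (k : Fin p) :
    ‖charMomentEst n x e t k‖ ≤ (n : ℝ)⁻¹ * ∑ j ∈ Finset.range n, |x j k| := by
  rw [charMomentEst, norm_mul, norm_inv, Complex.norm_natCast]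
  refine mul_le_mul_of_nonneg_left ((norm_sum_le _ _).trans (Finset.sum_le_sum fun j _ => ?_))
    (by positivity)
  rw [norm_mul, norm_exp_I_mul_mul, mul_one, Complex.norm_real, Real.norm_eq_abs]

/-- The effect on `m̂(e_j)` of replacing the residuals `e` by residuals `e'`, linear in the size `u`
of the perturbation. -/
theorem norm_charMomentEst_sub_le {n : ℕ} (x : ℕ → EuclideanSpace ℝ (Fin p)) {e e' : ℕ → ℝ}
    {u : ℝ} {G H : ℕ → ℝ} (hG : ∀ j, |e' j - e j| ≤ u * G j)
    (hH : ∀ j, |e' j| ≤ H j) (j : ℕ) (k : Fin p) :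
    ‖charMomentEst n x e' (e' j) k - charMomentEst n x e (e j) k‖ ≤
      u * (H j * ((n : ℝ)⁻¹ * ∑ l ∈ Finset.range n, |x l k| * G l) +
        G j * ((n : ℝ)⁻¹ * ∑ l ∈ Finset.range n, |x l k| * |e l|)) := by
  have h1 : ∀ l, ‖(x l k : ℂ) * Complex.exp (Complex.I * (e' j : ℂ) * (e' l : ℂ)) -
      (x l k : ℂ) * Complex.exp (Complex.I * (e j : ℂ) * (e l : ℂ))‖ ≤
      u * (H j * (|x l k| * G l) + G j * (|x l k| * |e l|)) := by
    intro l
    rw [← mul_sub, norm_mul, Complex.norm_real, Real.norm_eq_abs, mul_assoc, mul_assoc,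
      ← Complex.ofReal_mul, ← Complex.ofReal_mul]
    have h2 : |e' j * e' l - e j * e l| ≤ H j * (u * G l) + u * G j * |e l| := by
      have h3 : e' j * e' l - e j * e l = e' j * (e' l - e l) + (e' j - e j) * e l := by ring
      rw [h3]
      refine (abs_add_le _ _).trans (add_le_add ?_ ?_)
      · rw [abs_mul]
        exact mul_le_mul (hH j) (hG l) (abs_nonneg _) ((abs_nonneg _).trans (hH j))
      · rw [abs_mul]
        exact mul_le_mul_of_nonneg_right (hG j) (abs_nonneg _)
    have h4 := mul_le_mul_of_nonneg_left ((norm_exp_I_mul_sub_le _ _).trans h2) (abs_nonneg (x l k))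
    refine h4.trans (le_of_eq ?_)
    ring
  have h5 : charMomentEst n x e' (e' j) k - charMomentEst n x e (e j) k =
      (n : ℂ)⁻¹ * ∑ l ∈ Finset.range n,
        ((x l k : ℂ) * Complex.exp (Complex.I * (e' j : ℂ) * (e' l : ℂ)) -
          (x l k : ℂ) * Complex.exp (Complex.I * (e j : ℂ) * (e l : ℂ))) := by
    rw [Finset.sum_sub_distrib, mul_sub]
    rfl
  rw [h5, norm_mul, norm_inv, Complex.norm_natCast]
  calc (n : ℝ)⁻¹ * _ ≤ (n : ℝ)⁻¹ * ∑ l ∈ Finset.range n,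
        u * (H j * (|x l k| * G l) + G j * (|x l k| * |e l|)) :=
        mul_le_mul_of_nonneg_left ((norm_sum_le _ _).trans (Finset.sum_le_sum fun l _ => h1 l))
          (by positivity)
    _ = _ := by
        rw [← Finset.mul_sum, Finset.sum_add_distrib, ← Finset.mul_sum, ← Finset.mul_sum]
        ring

end CharMoment

/-! ### The rate of the empirical characteristic moments at the residuals -/

theorem sq_average_le (n : ℕ) (z : ℕ → ℝ) :
    ((n : ℝ)⁻¹ * ∑ j ∈ Finset.range n, z j) ^ 2 ≤ (n : ℝ)⁻¹ * ∑ j ∈ Finset.range n, z j ^ 2 := by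
  rcases Nat.eq_zero_or_pos n with rfl | hn
  · simp
  have hn' : (0 : ℝ) < n := by exact_mod_cast hn
  have h1 := sq_sum_le_card_mul_sum_sq (s := Finset.range n) (f := z)
  rw [Finset.card_range] at h1
  calc ((n : ℝ)⁻¹ * ∑ j ∈ Finset.range n, z j) ^ 2
      = (n : ℝ)⁻¹ ^ 2 * (∑ j ∈ Finset.range n, z j) ^ 2 := mul_pow _ _ _
    _ ≤ (n : ℝ)⁻¹ ^ 2 * (n * ∑ j ∈ Finset.range n, z j ^ 2) := by gcongr
    _ = _ := by field_simp

theorem frobenius_norm_le_sum_norm {p : ℕ} (A : Matrix (Fin p) (Fin p) ℂ) :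
    ‖A‖ ≤ ∑ k, ∑ l, ‖A k l‖ := by
  rw [Matrix.frobenius_norm_def, ← Real.sqrt_eq_rpow]
  refine Real.sqrt_le_iff.2 ⟨by positivity, ?_⟩
  simp_rw [Real.rpow_two]
  rw [← Finset.sum_product', ← Finset.sum_product']
  exact Finset.sum_sq_le_sq_sum_of_nonneg fun _ _ => norm_nonneg _

theorem measurable_euclideanSpace_apply {p : ℕ} (k : Fin p) :
    Measurable fun v : EuclideanSpace ℝ (Fin p) => v k :=
  (PiLp.continuous_apply 2 _ k).measurable

theorem measurable_mul_exp_I {α : Type*} [MeasurableSpace α] {b t e : α → ℝ} (hb : Measurable b)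
    (ht : Measurable t) (he : Measurable e) :
    Measurable fun a => (b a : ℂ) * Complex.exp (Complex.I * (t a : ℂ) * (e a : ℂ)) := by
  fun_prop

theorem norm_charMoment_le {Ω : Type*} [MeasurableSpace Ω] {μ : Measure Ω} {p : ℕ}
    {X : Ω → EuclideanSpace ℝ (Fin p)} (η : Ω → ℝ) (t : ℝ) (k : Fin p) :
    ‖charMoment μ X η t k‖ ≤ ∫ ω, |X ω k| ∂μ := by
  refine (norm_integral_le_integral_norm _).trans (le_of_eq ?_)
  simp_rw [norm_mul, norm_exp_I_mul_mul, mul_one, Complex.norm_real, Real.norm_eq_abs]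

section Rate

variable {Ω S : Type*} [MeasurableSpace Ω] [MeasurableSpace S] {μ : Measure Ω}
  {P : Measure S} {p d : ℕ}
  {X : Ω → EuclideanSpace ℝ (Fin p)} {Y : Ω → ℝ}
  {g : EuclideanSpace ℝ (Fin p) → EuclideanSpace ℝ (Fin d) → ℝ}
  {Θ : Set (EuclideanSpace ℝ (Fin d))} {θs : EuclideanSpace ℝ (Fin d)}

theorem charMoment_eq_integral_law (h : RegularityConditions μ X Y g Θ θs) (t : ℝ) (k : Fin p) :
    charMoment μ X (popResidual X Y g θs) t k =
      ∫ v, ((v.1 k : ℝ) : ℂ) * Complex.exp (Complex.I * (t : ℂ) * ((v.2 - g v.1 θs : ℝ) : ℂ))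
        ∂(μ.map fun ω => (X ω, Y ω)) := by
  rw [integral_map h.measurable_pair.aemeasurable]
  · rfl
  · have h1 : Measurable fun v : EuclideanSpace ℝ (Fin p) × ℝ => v.2 - g v.1 θs :=
      measurable_snd.sub ((h.measurable_g θs).comp measurable_fst)
    have h2 : Measurable fun v : EuclideanSpace ℝ (Fin p) × ℝ => v.1 k :=
      (measurable_euclideanSpace_apply k).comp measurable_fst
    exact (measurable_mul_exp_I h2 measurable_const h1).aestronglyMeasurable

/-- Under the null hypothesis `m` vanishes, since `X` is centred and independent of the
residual. -/
theorem charMoment_eq_zero_of_null (h : RegularityConditions μ X Y g Θ θs) {ε : Ω → ℝ}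
    (hε : Measurable ε) (hind : IndepFun X ε μ) (hmean : ∀ k, ∫ ω, X ω k ∂μ = 0)
    (hY : ∀ᵐ ω ∂μ, Y ω = g (X ω) θs + ε ω) (t : ℝ) :
    charMoment μ X (popResidual X Y g θs) t = 0 := by
  ext k
  have h1 : charMoment μ X (popResidual X Y g θs) t k =
      ∫ ω, (X ω k : ℂ) * Complex.exp (Complex.I * (t : ℂ) * (ε ω : ℂ)) ∂μ := by
    refine integral_congr_ae ?_
    filter_upwards [hY] with ω hω
    simp only [popResidual]
    rw [hω, add_sub_cancel_left]
  have hφ : Measurable fun x : EuclideanSpace ℝ (Fin p) => ((x k : ℝ) : ℂ) :=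
    Complex.measurable_ofReal.comp (measurable_euclideanSpace_apply k)
  have hψ : Measurable fun e : ℝ => Complex.exp (Complex.I * (t : ℂ) * (e : ℂ)) := by fun_prop
  have h2 := (hind.comp hφ hψ).integral_fun_mul_eq_mul_integral
    (hφ.comp h.measurable_X).aestronglyMeasurable (hψ.comp hε).aestronglyMeasurable
  rw [h1]
  refine h2.trans ?_
  have h3 : ∫ ω, ((X ω k : ℝ) : ℂ) ∂μ = 0 := by
    refine (integral_ofReal (𝕜 := ℂ) (f := fun ω => X ω k)).trans ?_
    rw [hmean k]
    rfl
  simp only [Function.comp_apply]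
  rw [h3, zero_mul]
  rfl

variable [IsProbabilityMeasure μ] [IsProbabilityMeasure P]

theorem memLp_two_of_integrable_pow_four {f : Ω → ℝ} (hf : Measurable f)
    (h4 : Integrable (fun ω => |f ω| ^ 4) μ) : MemLp f 2 μ := by
  rw [memLp_two_iff_integrable_sq hf.aestronglyMeasurable]
  refine Integrable.mono' (h4.add (integrable_const 1)) (hf.pow_const 2).aestronglyMeasurable
    (ae_of_all _ fun ω => ?_)
  have h1 : |f ω| ^ 4 = (f ω ^ 2) ^ 2 := by
    rw [← sq_abs (f ω)]; ring
  simp only [Pi.add_apply]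
  rw [Real.norm_eq_abs, abs_of_nonneg (sq_nonneg _), h1]
  nlinarith [sq_nonneg (f ω ^ 2 - 1)]

theorem measurable_charMoment (h : RegularityConditions μ X Y g Θ θs) (k : Fin p) :
    Measurable fun t => charMoment μ X (popResidual X Y g θs) t k := by
  have h1 : Measurable (popResidual X Y g θs) :=
    h.measurable_Y.sub ((h.measurable_g θs).comp h.measurable_X)
  have h2 : Measurable fun ω => X ω k := (measurable_euclideanSpace_apply k).comp h.measurable_X
  have h3 : Measurable fun z : ℝ × Ω => (X z.2 k : ℂ) *
      Complex.exp (Complex.I * (z.1 : ℂ) * (popResidual X Y g θs z.2 : ℂ)) :=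
    measurable_mul_exp_I (h2.comp measurable_snd) measurable_fst (h1.comp measurable_snd)
  exact (h3.stronglyMeasurable.integral_prod_right').measurable

/-- The mean squared deviation of `m̂(η̂_j)` from `m(η_j)` over the sample is `O_p(1/n)`. It
consists of the effect of estimating `θ*`, of the order of `‖θ̂ - θ*‖ ^ 2`, and of the sampling
error at the true residuals. -/
theorem isBigOInProbability_charMomentEst (h : RegularityConditions μ X Y g Θ θs)
    (hmoment : ∀ k, Integrable (fun ω => |X ω k| ^ 4) μ)
    {w : ℕ → S → EuclideanSpace ℝ (Fin p) × ℝ} (hw : ∀ j, Measurable (w j))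
    (hlaw : ∀ j, P.map (w j) = μ.map fun ω => (X ω, Y ω)) (hiid : iIndepFun w P)
    {θhat : ℕ → S → EuclideanSpace ℝ (Fin d)} (hmem : ∀ n, ∀ᵐ s ∂P, θhat n s ∈ Θ)
    (hrate : IsBigOInProbability P (fun n s => ‖θhat n s - θs‖) (fun n => (√n)⁻¹)) (k : Fin p) :
    IsBigOInProbability P (fun n s => (n : ℝ)⁻¹ * ∑ j ∈ Finset.range n,
      ‖charMomentEst n (fun j => (w j s).1) (fun j => (w j s).2 - g (w j s).1 (θhat n s))
          ((w j s).2 - g (w j s).1 (θhat n s)) k -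
        charMoment μ X (popResidual X Y g θs) ((w j s).2 - g (w j s).1 θs) k‖ ^ 2)
      (fun n => (n : ℝ)⁻¹) := by
  obtain ⟨Q, G, L, hE⟩ := h.exists_isEnvelope
  have hpair := h.measurable_pair.aemeasurable (μ := μ)
  set ν := μ.map fun ω => (X ω, Y ω) with hν
  have : IsProbabilityMeasure ν := Measure.isProbabilityMeasure_map hpair
  let η : EuclideanSpace ℝ (Fin p) × ℝ → ℝ := fun v => v.2 - g v.1 θs
  have hη : Measurable η := measurable_snd.sub ((h.measurable_g θs).comp measurable_fst)
  let m : ℝ → ℂ := fun t => charMoment μ X (popResidual X Y g θs) t k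
  have hm : Measurable m := measurable_charMoment h k
  let b : EuclideanSpace ℝ (Fin p) × ℝ → ℝ := fun v => v.1 k
  have hb : Measurable b := (measurable_euclideanSpace_apply k).comp measurable_fst
  have hXk : MemLp (fun ω => X ω k) 2 μ := memLp_two_of_integrable_pow_four
    ((measurable_euclideanSpace_apply k).comp h.measurable_X) (hmoment k)
  have hbL : MemLp b 2 ν := (memLp_map_measure_iff hb.aestronglyMeasurable hpair).2 hXk
  have hηL : MemLp η 2 ν := (memLp_map_measure_iff hη.aestronglyMeasurable hpair).2
    (h.memLp_Y.sub (h.memLp_g h.mem))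
  have hYL : MemLp (fun v : EuclideanSpace ℝ (Fin p) × ℝ => v.2) 2 ν :=
    (memLp_map_measure_iff measurable_snd.aestronglyMeasurable hpair).2 h.memLp_Y
  -- the envelope of the residuals
  let H : EuclideanSpace ℝ (Fin p) × ℝ → ℝ := fun v => |v.2| + Q v
  have hHm : Measurable H := measurable_snd.abs.add hE.measurable_Q
  have hHL : MemLp H 2 ν := hYL.abs.add hE.memLp_Q
  -- the sampling error at the true residuals
  let f : EuclideanSpace ℝ (Fin p) × ℝ → EuclideanSpace ℝ (Fin p) × ℝ → ℂ := fun v v' =>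
    (b v' : ℂ) * Complex.exp (Complex.I * (η v : ℂ) * (η v' : ℂ)) - m (η v)
  have hf : Measurable (Function.uncurry f) := by
    have h1 : Measurable fun z : (EuclideanSpace ℝ (Fin p) × ℝ) × (EuclideanSpace ℝ (Fin p) × ℝ) =>
        (b z.2 : ℂ) * Complex.exp (Complex.I * (η z.1 : ℂ) * (η z.2 : ℂ)) - m (η z.1) :=
      (measurable_mul_exp_I (hb.comp measurable_snd) (hη.comp measurable_fst)
        (hη.comp measurable_snd)).sub (hm.comp (hη.comp measurable_fst))
    exact h1
  let D : EuclideanSpace ℝ (Fin p) × ℝ → ℝ := fun v => |b v| + ∫ ω, |X ω k| ∂μ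
  have hDL : MemLp D 2 ν := hbL.abs.add (memLp_const _)
  have hfD : ∀ v v', ‖f v v'‖ ≤ D v' := by
    intro v v'
    refine (norm_sub_le _ _).trans (add_le_add (le_of_eq ?_) (norm_charMoment_le _ _ _))
    rw [norm_mul, norm_exp_I_mul_mul, mul_one, Complex.norm_real, Real.norm_eq_abs]
  have hf0 : ∀ v, ∫ v', f v v' ∂ν = 0 := by
    intro v
    have hi : Integrable (fun v' => (b v' : ℂ) * Complex.exp (Complex.I * (η v : ℂ) * (η v' : ℂ)))
        ν := by
      refine Integrable.mono' (hbL.abs.integrable one_le_two) ?_ (ae_of_all _ fun v' => ?_)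
      · exact (measurable_mul_exp_I hb measurable_const hη).aestronglyMeasurable
      · rw [norm_mul, norm_exp_I_mul_mul, mul_one, Complex.norm_real, Real.norm_eq_abs]
        exact le_rfl
    simp only [f]
    rw [integral_sub hi (integrable_const _), integral_const, probReal_univ, one_smul]
    simp only [m, charMoment_eq_integral_law h, b, η, hν, sub_self]
  let V : ℕ → S → ℝ := fun n s => (n : ℝ)⁻¹ * ∑ j ∈ Finset.range n,
    ‖(n : ℂ)⁻¹ * ∑ l ∈ Finset.range n, f (w j s) (w l s)‖ ^ 2
  have hVm : ∀ n j : ℕ, Measurable fun s =>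
      ‖(n : ℂ)⁻¹ * ∑ l ∈ Finset.range n, f (w j s) (w l s)‖ ^ 2 := fun n j =>
    (measurable_average_kernel hw hf n j).norm.pow_const 2
  have hV : IsBigOInProbability P V (fun n => (n : ℝ)⁻¹) := by
    refine IsBigOInProbability.of_lintegral_le (K := 2 * ∫ v, D v ^ 2 ∂ν)
      (fun n => ((Finset.measurable_sum _ fun j _ => hVm n j).const_mul _).aemeasurable)
      (fun n hn => by have : (0 : ℝ) < n := by exact_mod_cast hn
                      positivity) fun n hn => ?_
    have hn' : (0 : ℝ) < n := by exact_mod_cast hn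
    have hD0 : 0 ≤ ∫ v, D v ^ 2 ∂ν := integral_nonneg fun v => sq_nonneg _
    calc ∫⁻ s, ‖V n s‖ₑ ∂P
        ≤ ∫⁻ s, ‖(n : ℝ)⁻¹‖ₑ * ∑ j ∈ Finset.range n,
            ‖‖(n : ℂ)⁻¹ * ∑ l ∈ Finset.range n, f (w j s) (w l s)‖ ^ 2‖ₑ ∂P := by
          refine lintegral_mono fun s => ?_
          simp only [V]
          rw [enorm_mul]
          gcongr
          exact enorm_sum_le _ _
      _ = ‖(n : ℝ)⁻¹‖ₑ * ∑ j ∈ Finset.range n, ∫⁻ s,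
            ‖‖(n : ℂ)⁻¹ * ∑ l ∈ Finset.range n, f (w j s) (w l s)‖ ^ 2‖ₑ ∂P := by
          rw [lintegral_const_mul' _ _ (by simp [enorm_ne_top]),
            lintegral_finsetSum _ fun j _ => (hVm n j).enorm]
      _ ≤ ‖(n : ℝ)⁻¹‖ₑ * ∑ _j ∈ Finset.range n,
            ENNReal.ofReal (2 * (∫ v, D v ^ 2 ∂ν) * (n : ℝ)⁻¹) := by
          gcongr with j
          exact lintegral_norm_sq_average_kernel_le hw hlaw hiid hf hDL hfD hf0 hn j
      _ = ENNReal.ofReal (2 * (∫ v, D v ^ 2 ∂ν) * (n : ℝ)⁻¹) := by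
          rw [Finset.sum_const, Finset.card_range, nsmul_eq_mul, ← ENNReal.ofReal_natCast,
            ← ENNReal.ofReal_mul (by positivity), Real.enorm_of_nonneg (by positivity),
            ← ENNReal.ofReal_mul (by positivity)]
          congr 1
          field_simp
  -- the averages that multiply the squared error of `θhat`
  have hav : ∀ {φ : EuclideanSpace ℝ (Fin p) × ℝ → ℝ}, Measurable φ → Integrable φ ν →
      IsBigOInProbability P (fun n s => (n : ℝ)⁻¹ * ∑ j ∈ Finset.range n, φ (w j s))
        (fun _ => 1) := fun hφ hi => isBigOInProbability_average hw hlaw hφ hi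
  have hA := hav (φ := fun v => |b v| * G v) (hb.abs.mul hE.measurable_G)
    (hbL.abs.integrable_mul hE.memLp_G)
  have hB := hav (φ := fun v => |b v| * |η v|) (hb.abs.mul hη.abs)
    (hbL.abs.integrable_mul hηL.abs)
  have hH2 := hav (φ := fun v => H v ^ 2) (hHm.pow_const 2) hHL.integrable_sq
  have hG2 := hav (φ := fun v => G v ^ 2) (hE.measurable_G.pow_const 2) hE.memLp_G.integrable_sq
  have hone : ∀ _n : ℕ, (0 : ℝ) ≤ 1 := fun _ => zero_le_one
  have hprod := (((hA.mul hA hone).mul hH2 (by simp)).congr_rate (b := fun _ => 1) (by simp)).add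
    (((hB.mul hB hone).mul hG2 (by simp)).congr_rate (b := fun _ => 1) (by simp))
  have hu := (hrate.mul hrate fun n => by positivity).mul hprod fun n => by positivity
  have hu' := ((hu.congr_rate (b := fun n => (n : ℝ)⁻¹) fun n _ => by
    rw [mul_one, ← mul_inv, Real.mul_self_sqrt (Nat.cast_nonneg n)]).const_mul 4).add
      (hV.const_mul 2)
  refine hu'.mono fun n hn => ?_
  have haes : ∀ᵐ s ∂P, ∀ j, (∀ θ ∈ Θ, |g (w j s).1 θ| ≤ Q (w j s)) ∧
      (∀ θ ∈ Θ, ∀ θ' ∈ Θ, |g (w j s).1 θ - g (w j s).1 θ'| ≤ G (w j s) * ‖θ - θ'‖) := by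
    refine ae_all_iff.2 fun j => ?_
    have h1 := hE.abs_le.and hE.lipschitz
    rw [← hlaw j] at h1
    exact ae_of_ae_map (hw j).aemeasurable h1
  filter_upwards [haes, hmem n] with s hs hθ
  have hn' : (0 : ℝ) < n := by exact_mod_cast hn
  set u := ‖θhat n s - θs‖ with hu_def
  set A := (n : ℝ)⁻¹ * ∑ j ∈ Finset.range n, |b (w j s)| * G (w j s) with hAdef
  set B := (n : ℝ)⁻¹ * ∑ j ∈ Finset.range n, |b (w j s)| * |η (w j s)| with hBdef
  have hterm : ∀ j, ‖charMomentEst n (fun j => (w j s).1)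
        (fun j => (w j s).2 - g (w j s).1 (θhat n s))
          ((w j s).2 - g (w j s).1 (θhat n s)) k -
        charMoment μ X (popResidual X Y g θs) ((w j s).2 - g (w j s).1 θs) k‖ ^ 2 ≤
      4 * u ^ 2 * A ^ 2 * H (w j s) ^ 2 + 4 * u ^ 2 * B ^ 2 * G (w j s) ^ 2 +
        2 * ‖(n : ℂ)⁻¹ * ∑ l ∈ Finset.range n, f (w j s) (w l s)‖ ^ 2 := by
    intro j
    have h1 := norm_charMomentEst_sub_le (n := n) (fun j => (w j s).1)
      (e := fun j => (w j s).2 - g (w j s).1 θs)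
      (e' := fun j => (w j s).2 - g (w j s).1 (θhat n s)) (u := u) (G := fun j => G (w j s))
      (H := fun j => H (w j s))
      (fun j => by
        have h2 := (hs j).2 _ hθ _ h.mem
        rw [← abs_neg] at h2
        calc _ = |-(g (w j s).1 (θhat n s) - g (w j s).1 θs)| := by congr 1; ring
          _ ≤ _ := by rw [mul_comm]; exact h2)
      (fun j => (abs_sub _ _).trans (add_le_add le_rfl ((hs j).1 _ hθ))) j k
    have h2 : (n : ℂ)⁻¹ * ∑ l ∈ Finset.range n, f (w j s) (w l s) =
        charMomentEst n (fun j => (w j s).1) (fun j => (w j s).2 - g (w j s).1 θs)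
          ((w j s).2 - g (w j s).1 θs) k -
        charMoment μ X (popResidual X Y g θs) ((w j s).2 - g (w j s).1 θs) k := by
      have hnc : (n : ℂ) ≠ 0 := by exact_mod_cast hn'.ne'
      simp only [f, m, η, b, charMomentEst]
      rw [Finset.sum_sub_distrib, Finset.sum_const, Finset.card_range, nsmul_eq_mul, mul_sub,
        inv_mul_cancel_left₀ hnc]
    rw [h2]
    set z₁ := charMomentEst n (fun j => (w j s).1) (fun j => (w j s).2 - g (w j s).1 (θhat n s))
          ((w j s).2 - g (w j s).1 (θhat n s)) k
    set z₂ := charMomentEst n (fun j => (w j s).1) (fun j => (w j s).2 - g (w j s).1 θs)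
          ((w j s).2 - g (w j s).1 θs) k
    set z₃ := charMoment μ X (popResidual X Y g θs) ((w j s).2 - g (w j s).1 θs) k
    have h3 : ‖z₁ - z₃‖ ≤ ‖z₁ - z₂‖ + ‖z₂ - z₃‖ := norm_sub_le_norm_sub_add_norm_sub _ _ _
    have h4 : ‖z₁ - z₂‖ ≤ u * (H (w j s) * A + G (w j s) * B) := h1
    have h5 := pow_le_pow_left₀ (norm_nonneg _) h3 2
    have h6 := pow_le_pow_left₀ (norm_nonneg _) h4 2
    nlinarith [sq_nonneg (‖z₁ - z₂‖ - ‖z₂ - z₃‖),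
      mul_nonneg (sq_nonneg u) (sq_nonneg (H (w j s) * A - G (w j s) * B))]
  rw [abs_of_nonneg (mul_nonneg (by positivity)
    (Finset.sum_nonneg fun j _ => sq_nonneg _))]
  refine le_trans ?_ (le_abs_self _)
  calc _ ≤ (n : ℝ)⁻¹ * ∑ j ∈ Finset.range n,
        (4 * u ^ 2 * A ^ 2 * H (w j s) ^ 2 + 4 * u ^ 2 * B ^ 2 * G (w j s) ^ 2 +
          2 * ‖(n : ℂ)⁻¹ * ∑ l ∈ Finset.range n, f (w j s) (w l s)‖ ^ 2) :=
        mul_le_mul_of_nonneg_left (Finset.sum_le_sum fun j _ => hterm j) (by positivity)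
    _ = _ := by
        rw [Finset.sum_add_distrib, Finset.sum_add_distrib, ← Finset.mul_sum, ← Finset.mul_sum,
          ← Finset.mul_sum]
        simp only [V]
        ring

/-! ### From characteristic moments to the target matrix -/

theorem targetMatrixEst_apply (n : ℕ) (x : ℕ → EuclideanSpace ℝ (Fin p)) (y : ℕ → ℝ)
    (θ : EuclideanSpace ℝ (Fin d)) (k l : Fin p) :
    targetMatrixEst g n x y θ k l = (n : ℂ)⁻¹ * ∑ j ∈ Finset.range n,
      charMomentEst n x (fun j => y j - g (x j) θ) (y j - g (x j) θ) k *
        star (charMomentEst n x (fun j => y j - g (x j) θ) (y j - g (x j) θ) l) := by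
  simp only [targetMatrixEst, Matrix.smul_apply, Matrix.sum_apply, Matrix.vecMulVec_apply,
    Pi.star_apply, smul_eq_mul]

theorem norm_average_mul_star_le (n : ℕ) (a b : ℕ → ℂ) :
    ‖(n : ℂ)⁻¹ * ∑ j ∈ Finset.range n, a j * star (b j)‖ ≤
      (n : ℝ)⁻¹ * ∑ j ∈ Finset.range n, ‖a j‖ ^ 2 +
        (n : ℝ)⁻¹ * ∑ j ∈ Finset.range n, ‖b j‖ ^ 2 := by
  rw [norm_mul, norm_inv, Complex.norm_natCast, ← mul_add, ← Finset.sum_add_distrib]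
  refine mul_le_mul_of_nonneg_left ((norm_sum_le _ _).trans (Finset.sum_le_sum fun j _ => ?_))
    (by positivity)
  rw [norm_mul, norm_star]
  nlinarith [sq_nonneg (‖a j‖ - ‖b j‖), sq_nonneg ‖a j‖, sq_nonneg ‖b j‖]

/-- The Cauchy–Schwarz inequality passes from mean squared deviations to mean absolute ones. -/
theorem norm_average_mul_star_sub_le (n : ℕ) (a b a' b' : ℕ → ℂ) {α β : ℝ}
    (hα : ∀ j, ‖b j‖ ≤ α) (hβ : ∀ j, ‖a' j‖ ≤ β) :
    ‖(n : ℂ)⁻¹ * ∑ j ∈ Finset.range n, (a j * star (b j) - a' j * star (b' j))‖ ≤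
      √((n : ℝ)⁻¹ * ∑ j ∈ Finset.range n, ‖a j - a' j‖ ^ 2) * α +
        β * √((n : ℝ)⁻¹ * ∑ j ∈ Finset.range n, ‖b j - b' j‖ ^ 2) := by
  have hα0 : 0 ≤ α := (norm_nonneg _).trans (hα 0)
  have hβ0 : 0 ≤ β := (norm_nonneg _).trans (hβ 0)
  have h1 := Real.le_sqrt_of_sq_le (sq_average_le n fun j => ‖a j - a' j‖)
  have h2 := Real.le_sqrt_of_sq_le (sq_average_le n fun j => ‖b j - b' j‖)
  calc _ ≤ (n : ℝ)⁻¹ * ∑ j ∈ Finset.range n, (‖a j - a' j‖ * α + β * ‖b j - b' j‖) := by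
        rw [norm_mul, norm_inv, Complex.norm_natCast]
        refine mul_le_mul_of_nonneg_left ((norm_sum_le _ _).trans
          (Finset.sum_le_sum fun j _ => ?_)) (by positivity)
        have h3 : a j * star (b j) - a' j * star (b' j) =
            (a j - a' j) * star (b j) + a' j * star (b j - b' j) := by rw [star_sub]; ring
        rw [h3]
        refine (norm_add_le _ _).trans (add_le_add ?_ ?_)
        · rw [norm_mul, norm_star]
          exact mul_le_mul_of_nonneg_left (hα j) (norm_nonneg _)
        · rw [norm_mul, norm_star]
          exact mul_le_mul_of_nonneg_right (hβ j) (norm_nonneg _)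
    _ = ((n : ℝ)⁻¹ * ∑ j ∈ Finset.range n, ‖a j - a' j‖) * α +
        β * ((n : ℝ)⁻¹ * ∑ j ∈ Finset.range n, ‖b j - b' j‖) := by
        rw [Finset.sum_add_distrib, ← Finset.sum_mul, ← Finset.mul_sum]
        ring
    _ ≤ _ := by gcongr

theorem isBigOInProbability_minimizer_leastSquares (h : RegularityConditions μ X Y g Θ θs)
    (hloc : ∃ c > 0, ∃ r > 0, ∀ θ ∈ Θ, ‖θ - θs‖ < r →
      risk μ X Y g θs + c * ‖θ - θs‖ ^ 2 ≤ risk μ X Y g θ)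
    {w : ℕ → S → EuclideanSpace ℝ (Fin p) × ℝ} (hw : ∀ j, Measurable (w j))
    (hlaw : ∀ j, P.map (w j) = μ.map fun ω => (X ω, Y ω)) (hiid : iIndepFun w P)
    {θhat : ℕ → S → EuclideanSpace ℝ (Fin d)}
    (hls : ∀ n, ∀ᵐ s ∂P,
      IsLeastSquares g Θ n (fun j => (w j s).1) (fun j => (w j s).2) (θhat n s)) :
    IsBigOInProbability P (fun n s => ‖θhat n s - θs‖) (fun n => (√n)⁻¹) := by
  obtain ⟨c, hc, hgrow⟩ := h.exists_global_growth hloc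
  obtain ⟨Q, G, L, hE⟩ := h.exists_isEnvelope
  have : IsProbabilityMeasure (μ.map fun ω => (X ω, Y ω)) :=
    Measure.isProbabilityMeasure_map h.measurable_pair.aemeasurable
  have hm : ∀ θ, Measurable fun v : EuclideanSpace ℝ (Fin p) × ℝ => (v.2 - g v.1 θ) ^ 2 := fun θ =>
    (measurable_snd.sub ((h.measurable_g θ).comp measurable_fst)).pow_const 2
  have hi := fun θ (hθ : θ ∈ Θ) => h.integrable_sq_residual hθ
  have hgrow' : ∀ θ ∈ Θ, ∫ v, (v.2 - g v.1 θs) ^ 2 ∂(μ.map fun ω => (X ω, Y ω)) +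
      c * ‖θ - θs‖ ^ 2 ≤ ∫ v, (v.2 - g v.1 θ) ^ 2 ∂(μ.map fun ω => (X ω, Y ω)) := by
    intro θ hθ
    rw [← h.risk_eq, ← h.risk_eq]
    exact hgrow θ hθ
  have hmin : ∀ n, ∀ᵐ s ∂P, θhat n s ∈ Θ ∧ ∀ θ' ∈ Θ,
      ∑ j ∈ Finset.range n, ((w j s).2 - g (w j s).1 (θhat n s)) ^ 2 ≤
        ∑ j ∈ Finset.range n, ((w j s).2 - g (w j s).1 θ') ^ 2 := fun n =>
    (hls n).mono fun s hs => ⟨hs.1, hs.2⟩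
  exact isBigOInProbability_minimizer (ν := μ.map fun ω => (X ω, Y ω)) (Θ := Θ) (c := θs) h.mem
    (f := fun θ v => (v.2 - g v.1 θ) ^ 2) hm hi (L := L) hE.nonneg_L hE.memLp_L hE.lipschitz_sq
    hc hgrow' hw hlaw hiid hmin

/-- If `m` vanishes, then `M = 0` and `M̂_n` is quadratic in the deviations of `m̂_n` from `m`, so that
it has the squared rate. -/
theorem isBigOInProbability_targetMatrixEst_of_charMoment_eq_zero
    (h : RegularityConditions μ X Y g Θ θs)
    (hmoment : ∀ k, Integrable (fun ω => |X ω k| ^ 4) μ)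
    {w : ℕ → S → EuclideanSpace ℝ (Fin p) × ℝ} (hw : ∀ j, Measurable (w j))
    (hlaw : ∀ j, P.map (w j) = μ.map fun ω => (X ω, Y ω)) (hiid : iIndepFun w P)
    {θhat : ℕ → S → EuclideanSpace ℝ (Fin d)} (hmem : ∀ n, ∀ᵐ s ∂P, θhat n s ∈ Θ)
    (hrate : IsBigOInProbability P (fun n s => ‖θhat n s - θs‖) (fun n => (√n)⁻¹))
    (hzero : ∀ t, charMoment μ X (popResidual X Y g θs) t = 0) :
    IsBigOInProbability P
      (fun n s => ‖targetMatrixEst g n (fun j => (w j s).1) (fun j => (w j s).2) (θhat n s) -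
        targetMatrix μ X (popResidual X Y g θs)‖) (fun n => (n : ℝ)⁻¹) := by
  have hM : targetMatrix μ X (popResidual X Y g θs) = 0 := by
    ext k l
    simp [targetMatrix, hzero, Matrix.vecMulVec_apply]
  have hD := isBigOInProbability_charMomentEst h hmoment hw hlaw hiid hmem hrate
  simp only [hzero, Pi.zero_apply, sub_zero] at hD
  have hinv : ∀ n : ℕ, (0 : ℝ) ≤ (n : ℝ)⁻¹ := fun n => by positivity
  refine (IsBigOInProbability.sum Finset.univ (fun k _ => IsBigOInProbability.sum Finset.univ
    (fun l _ => (hD k).add (hD l)) hinv) hinv).mono fun n _ => ae_of_all _ fun s => ?_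
  rw [hM, sub_zero, abs_norm]
  refine (frobenius_norm_le_sum_norm _).trans (le_trans ?_ (le_abs_self _))
  refine Finset.sum_le_sum fun k _ => Finset.sum_le_sum fun l _ => ?_
  rw [targetMatrixEst_apply]
  exact norm_average_mul_star_le n _ _

/-- In general `M̂_n - M` is linear in the deviations of `m̂_n` from `m`, up to the deviation of the
average of `m(η_j) m(η_j)ᴴ` from its mean `M`. -/
theorem isBigOInProbability_targetMatrixEst (h : RegularityConditions μ X Y g Θ θs)
    (hmoment : ∀ k, Integrable (fun ω => |X ω k| ^ 4) μ)
    {w : ℕ → S → EuclideanSpace ℝ (Fin p) × ℝ} (hw : ∀ j, Measurable (w j))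
    (hlaw : ∀ j, P.map (w j) = μ.map fun ω => (X ω, Y ω)) (hiid : iIndepFun w P)
    {θhat : ℕ → S → EuclideanSpace ℝ (Fin d)} (hmem : ∀ n, ∀ᵐ s ∂P, θhat n s ∈ Θ)
    (hrate : IsBigOInProbability P (fun n s => ‖θhat n s - θs‖) (fun n => (√n)⁻¹)) :
    IsBigOInProbability P
      (fun n s => ‖targetMatrixEst g n (fun j => (w j s).1) (fun j => (w j s).2) (θhat n s) -
        targetMatrix μ X (popResidual X Y g θs)‖) (fun n => √((n : ℝ)⁻¹)) := by
  have hpair := h.measurable_pair.aemeasurable (μ := μ)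
  set ν := μ.map fun ω => (X ω, Y ω) with hν
  have : IsProbabilityMeasure ν := Measure.isProbabilityMeasure_map hpair
  have hD := fun k => (isBigOInProbability_charMomentEst h hmoment hw hlaw hiid hmem hrate k).sqrt
  have hbm : ∀ k, Measurable fun v : EuclideanSpace ℝ (Fin p) × ℝ => |v.1 k| := fun k =>
    ((measurable_euclideanSpace_apply k).comp measurable_fst).abs
  have hA : ∀ k, IsBigOInProbability P
      (fun n s => (n : ℝ)⁻¹ * ∑ j ∈ Finset.range n, |(w j s).1 k|) (fun _ => 1) := fun k =>
    isBigOInProbability_average hw hlaw (hbm k)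
      ((integrable_map_measure (hbm k).aestronglyMeasurable hpair).2
        ((memLp_two_of_integrable_pow_four ((measurable_euclideanSpace_apply k).comp
          h.measurable_X) (hmoment k)).abs.integrable one_le_two))
  let η : EuclideanSpace ℝ (Fin p) × ℝ → ℝ := fun v => v.2 - g v.1 θs
  have hη : Measurable η := measurable_snd.sub ((h.measurable_g θs).comp measurable_fst)
  let m : Fin p → ℝ → ℂ := fun k t => charMoment μ X (popResidual X Y g θs) t k
  have hm : ∀ k, Measurable (m k) := measurable_charMoment h
  let F : Fin p → Fin p → EuclideanSpace ℝ (Fin p) × ℝ → ℂ := fun k l v =>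
    m k (η v) * star (m l (η v))
  have hFm : ∀ k l, Measurable (F k l) := fun k l =>
    ((hm k).comp hη).mul (continuous_star.measurable.comp ((hm l).comp hη))
  have hFint : ∀ k l, targetMatrix μ X (popResidual X Y g θs) k l = ∫ v, F k l v ∂ν := by
    intro k l
    have h1 : Measurable fun t => m k t * star (m l t) := 
      (hm k).mul (continuous_star.measurable.comp (hm l))
    have h2 : Measurable (popResidual X Y g θs) :=
      h.measurable_Y.sub ((h.measurable_g θs).comp h.measurable_X)
    rw [hν, integral_map hpair (hFm k l).aestronglyMeasurable]
    simp only [targetMatrix, Matrix.of_apply, Matrix.vecMulVec_apply, Pi.star_apply]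
    exact integral_map h2.aemeasurable h1.aestronglyMeasurable
  have hFL : ∀ k l, MemLp (F k l) 2 ν := by
    intro k l
    refine MemLp.of_bound (hFm k l).aestronglyMeasurable
      ((∫ ω, |X ω k| ∂μ) * ∫ ω, |X ω l| ∂μ) (ae_of_all _ fun v => ?_)
    simp only [F, m]
    rw [norm_mul, norm_star]
    exact mul_le_mul (norm_charMoment_le _ _ _) (norm_charMoment_le _ _ _) (norm_nonneg _)
      (integral_nonneg fun ω => abs_nonneg _)
  have hT := fun k l => isBigOInProbability_average_sub_integral hw hlaw hiid (hFm k l) (hFL k l)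
  have hsq : ∀ n : ℕ, (0 : ℝ) ≤ √((n : ℝ)⁻¹) := fun n => Real.sqrt_nonneg _
  have hentry := fun k l => (((hD k).mul (hA l) hsq).congr_rate (b := fun n => √((n : ℝ)⁻¹))
    (by simp)).add ((hD l).const_mul (∫ ω, |X ω k| ∂μ)) |>.add (hT k l)
  refine (IsBigOInProbability.sum Finset.univ (fun k _ => IsBigOInProbability.sum Finset.univ
    (fun l _ => hentry k l) hsq) hsq).mono fun n _ => ae_of_all _ fun s => ?_
  rw [abs_norm]
  refine (frobenius_norm_le_sum_norm _).trans (le_trans ?_ (le_abs_self _))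
  refine Finset.sum_le_sum fun k _ => Finset.sum_le_sum fun l _ => ?_
  rw [Matrix.sub_apply, targetMatrixEst_apply, hFint]
  set e : ℕ → ℝ := fun j => (w j s).2 - g (w j s).1 (θhat n s) with he
  set a : Fin p → ℕ → ℂ := fun k j => charMomentEst n (fun j => (w j s).1) e (e j) k with ha
  have h1 := norm_average_mul_star_sub_le n (a k) (a l) (fun j => m k (η (w j s)))
    (fun j => m l (η (w j s))) (fun j => norm_charMomentEst_le n _ _ _ l)
    (fun j => norm_charMoment_le (popResidual X Y g θs) (η (w j s)) k)
  have h2 : (n : ℂ)⁻¹ * ∑ j ∈ Finset.range n, a k j * star (a l j) - ∫ v, F k l v ∂ν =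
      (n : ℂ)⁻¹ * ∑ j ∈ Finset.range n, (a k j * star (a l j) - F k l (w j s)) +
        ((n : ℂ)⁻¹ * ∑ j ∈ Finset.range n, F k l (w j s) - ∫ v, F k l v ∂ν) := by
    rw [Finset.sum_sub_distrib]
    ring
  refine (le_of_eq (congrArg norm h2)).trans ((norm_add_le _ _).trans (add_le_add h1 le_rfl))

end Rate

theorem mainTheorem6 {Ω S : Type*} [MeasurableSpace Ω] [MeasurableSpace S]
    (μ : Measure Ω) [IsProbabilityMeasure μ] (P : Measure S) [IsProbabilityMeasure P]
    {p d : ℕ}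
    -- the population
    (X : Ω → EuclideanSpace ℝ (Fin p)) (Y ε : Ω → ℝ)
    (g : EuclideanSpace ℝ (Fin p) → EuclideanSpace ℝ (Fin d) → ℝ)
    (Θ : Set (EuclideanSpace ℝ (Fin d))) (θs : EuclideanSpace ℝ (Fin d))
    (hreg : RegularityConditions μ X Y g Θ θs)
    (hε : Measurable ε) (hind : IndepFun X ε μ)
    (hmean : ∀ k, ∫ ω, X ω k ∂μ = 0)
    (hmoment : ∀ k, Integrable (fun ω => |X ω k| ^ 4) μ)
    -- the i.i.d. sample from the law of `(X, Y)`
    (x : ℕ → S → EuclideanSpace ℝ (Fin p)) (y : ℕ → S → ℝ)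
    (hiid : iIndepFun (fun j s => (x j s, y j s)) P)
    (hlaw : ∀ j, IdentDistrib (fun s => (x j s, y j s)) (fun ω => (X ω, Y ω)) P μ)
    -- the least squares estimator
    (θhat : ℕ → S → EuclideanSpace ℝ (Fin d)) (hmeas : ∀ n, Measurable (θhat n))
    (hls : ∀ n, ∀ᵐ s ∂P, IsLeastSquares g Θ n (fun j => x j s) (fun j => y j s) (θhat n s)) :
    -- under the null hypothesis (with `θs` an interior point)
    (NullHypothesis μ X Y ε g Θ → θs ∈ interior Θ →
      IsBigOInProbability P
        (fun n s => ‖targetMatrixEst g n (fun j => x j s) (fun j => y j s) (θhat n s) -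
          targetMatrix μ X (popResidual X Y g θs)‖)
        (fun n => (n : ℝ)⁻¹)) ∧
    -- under the alternative hypothesis (with `θs` a nondegenerate minimiser)
    (AlternativeHypothesis μ X Y ε g Θ →
      (∃ c > 0, ∃ r > 0, ∀ θ ∈ Θ, ‖θ - θs‖ < r →
        risk μ X Y g θs + c * ‖θ - θs‖ ^ 2 ≤ risk μ X Y g θ) →
      IsBigOInProbability P
        (fun n s => ‖targetMatrixEst g n (fun j => x j s) (fun j => y j s) (θhat n s) -
          targetMatrix μ X (popResidual X Y g θs)‖)
        (fun n => (n : ℝ) ^ (-(1 / 2) : ℝ))) := by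
  have hpair := hreg.measurable_pair.aemeasurable (μ := μ)
  -- the sample is only almost everywhere measurable, so it is replaced by a measurable version
  have haem : ∀ j, AEMeasurable (fun s => (x j s, y j s)) P := fun j => (hlaw j).aemeasurable_fst
  let w : ℕ → S → EuclideanSpace ℝ (Fin p) × ℝ := fun j => (haem j).mk _
  have hw : ∀ j, Measurable (w j) := fun j => (haem j).measurable_mk
  have hwe : ∀ j, (fun s => (x j s, y j s)) =ᵐ[P] w j := fun j => (haem j).ae_eq_mk
  have hwlaw : ∀ j, P.map (w j) = μ.map fun ω => (X ω, Y ω) := fun j => by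
    rw [← Measure.map_congr (hwe j)]
    exact (hlaw j).map_eq
  have hwiid : iIndepFun w P := hiid.congr hwe
  have hall : ∀ᵐ s ∂P, ∀ j, (x j s, y j s) = w j s := ae_all_iff.2 hwe
  have hfun : ∀ᵐ s ∂P, (fun j => x j s) = (fun j => (w j s).1) ∧
      (fun j => y j s) = fun j => (w j s).2 := by
    filter_upwards [hall] with s hs
    exact ⟨funext fun j => congrArg Prod.fst (hs j), funext fun j => congrArg Prod.snd (hs j)⟩
  have hwls : ∀ n, ∀ᵐ s ∂P,
      IsLeastSquares g Θ n (fun j => (w j s).1) (fun j => (w j s).2) (θhat n s) := by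
    intro n
    filter_upwards [hls n, hfun] with s hs hf
    rwa [hf.1, hf.2] at hs
  have hmem : ∀ n, ∀ᵐ s ∂P, θhat n s ∈ Θ := fun n => (hwls n).mono fun s hs => hs.1
  have htransfer : ∀ {a : ℕ → ℝ}, IsBigOInProbability P
      (fun n s => ‖targetMatrixEst g n (fun j => (w j s).1) (fun j => (w j s).2) (θhat n s) -
        targetMatrix μ X (popResidual X Y g θs)‖) a →
      IsBigOInProbability P
        (fun n s => ‖targetMatrixEst g n (fun j => x j s) (fun j => y j s) (θhat n s) -
          targetMatrix μ X (popResidual X Y g θs)‖) a := fun hO =>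
    hO.mono fun n _ => by
      filter_upwards [hfun] with s hf
      rw [hf.1, hf.2]
  refine ⟨fun ⟨hε0, θ₀, hθ₀, hY⟩ _ => htransfer ?_, fun _ hloc => htransfer ?_⟩
  · obtain rfl := hreg.eq_of_null hind hε0 hθ₀ hY
    exact isBigOInProbability_targetMatrixEst_of_charMoment_eq_zero hreg hmoment hw hwlaw hwiid hmem
      (isBigOInProbability_minimizer_leastSquares hreg
        (hreg.exists_local_growth_of_null hind hε0 hY) hw hwlaw hwiid hwls)
      (charMoment_eq_zero_of_null hreg hε hind hmean hY)
  · refine (isBigOInProbability_targetMatrixEst hreg hmoment hw hwlaw hwiid hmem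
      (isBigOInProbability_minimizer_leastSquares hreg hloc hw hwlaw hwiid hwls)).congr_rate
      fun n _ => ?_
    rw [Real.rpow_neg (Nat.cast_nonneg n), ← Real.sqrt_eq_rpow, Real.sqrt_inv]
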